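/- Let $d\ge 2$, let $\mathcal S(\mathbb S^{d-1})=C^\infty(\mathbb S^{d-1};\mathbb C)$ carry the topology generated by the norms $\|(\mathrm{Id}-\Delta)^k h\|_\infty$, $k\in\mathbb N$ ($\Delta$ the Laplace–Beltrami operator), and let $\mathcal S'(\mathbb S^{d-1})$ be its topological dual, the space of distributions. Let $\mathcal D$ be a linear operator on $\mathcal S(\mathbb S^{d-1})$ of the form $$\mathcal D h=\sum_{k\ge 0}\hat D_k\sum_m\langle h,Y_k^m\rangle_{L^2}\,Y_k^m ,$$ where $(Y_k^m)_m$ is an orthonormal basis of the space of spherical harmonics $\{Y:\Delta Y=-k(k+d-2)Y\}$, the symbol $(\hat D_k)$ is real with finitely many zeros, and $|\hat D_k|=\Theta(k^p)$ for some $p\ge 0$. Assume that $\mathcal D$ has trivial nullspace. Let $\mathcal D$ act on distributions by $\langle\mathcal Df|\varphi\rangle:=\langle f|\mathcal D\varphi\rangle$, and identify continuous functions $\eta$ and complex Borel measures $\mu$ on $\mathbb S^{d-1}$ with the distributions $\varphi\mapsto\int\eta\varphi$ (surface measure) and $\varphi\mapsto\int\varphi\,d\mu$. Put $$\mathcal C_{\mathcal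 D}=\{h\in\mathcal S':h=\mathcal D\eta,\ \eta\in C(\mathbb S^{d-1})\},\qquad \mathcal M_{\mathcal D}=\{f\in\mathcal S':\mathcal Df \text{ is a complex Borel measure}\}.$$ Then: 1. For every $\eta\in C(\mathbb S^{d-1})$, $\mathcal D\eta$ is an element of $\mathcal C_{\mathcal D}$; every $h\in\mathcal C_{\mathcal D}$ is $\mathcal D\eta$ for exactly one continuous $\eta=:\mathcal D^{-1}h$; and $\mathcal C_{\mathcal D}$ with the norm $\|h\|_{\mathcal D,\infty}=\|\mathcal D^{-1}h\|_\infty$ is a Banach space. 2. For every complex Borel measure $\mu$ there is exactly one $f\in\mathcal M_{\mathcal D}$ with $\mathcal Df=\mu$; for every $f\in\mathcal M_{\mathcal D}$ the measure $\mathcal Df$ is unique; and $\mathcal M_{\mathcal D}$ with the norm $\|f\|_{\mathcal D,TV}=\|\mathcal Df\|_{TV}=\sup\{|\langle \mathcal Df|\varphi\rangle| : \varphi\in\mathcal S(\mathbb S^{d-1}),\ \|\varphi\|_\infty=1\}$ is a Banach space. 3. $\mathcal C_{\mathcal D}$ is the predual of $\mathcal M_{\mathcal D}$: there is a linear isometric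 isomorphism from $(\mathcal M_{\mathcal D},\|\cdot\|_{\mathcal D,TV})$ onto the topological dual of $(\mathcal C_{\mathcal D},\|\cdot\|_{\mathcal D,\infty})$ with its dual norm. It is given by $\langle f|h\rangle=\int \mathcal D^{-1}h\;d(\mathcal Df)$; moreover $\mathcal S(\mathbb S^{d-1})\subset\mathcal C_{\mathcal D}$, and for $\varphi\in\mathcal S(\mathbb S^{d-1})$ it agrees with the duality product $\langle f|\varphi\rangle$. -/

import Mathlib

open scoped Manifold ContDiff ComplexConjugate
open MeasureTheory Filter Topology

noncomputable section

/-! ### The sphere, smooth functions and the Laplace-Beltrami operator -/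

/-- The unit sphere of `ℝ ^ (n + 1)` (the sphere `𝕊^{d-1}` with `d = n + 1`). -/
abbrev Sph (n : ℕ) : Type := Metric.sphere (0 : EuclideanSpace ℝ (Fin (n + 1))) 1

/-- The surface measure of the sphere. -/
abbrev sphMeasure (n : ℕ) : Measure (Sph n) :=
  (volume : Measure (EuclideanSpace ℝ (Fin (n + 1)))).toSphere

/-- The Schwartz space of the sphere: the complex valued functions of class `C^∞`. -/
def SphSmooth (n : ℕ) : Submodule ℂ (Sph n → ℂ) where
  carrier := {h | ContMDiff (𝓡 n) 𝓘(ℝ, ℂ) ∞ h}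
  add_mem' hf hg := ContMDiff.add hf hg
  zero_mem' := contMDiff_const
  smul_mem' c _ hf := (ContinuousLinearMap.mul ℝ ℂ c).contMDiff.comp hf

/-- The Schwartz space as a type of its own (it gets the `C^∞` topology below, not the topology of
pointwise convergence). -/
def Schwartz (n : ℕ) : Type := SphSmooth n

namespace Schwartz

variable {n : ℕ}

instance : AddCommGroup (Schwartz n) := inferInstanceAs (AddCommGroup (SphSmooth n))
instance : Module ℂ (Schwartz n) := inferInstanceAs (Module ℂ (SphSmooth n))
instance : CoeFun (Schwartz n) (fun _ => Sph n → ℂ) := ⟨fun h => h.1⟩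

theorem contMDiff (h : Schwartz n) : ContMDiff (𝓡 n) 𝓘(ℝ, ℂ) ∞ (h : Sph n → ℂ) := h.2

@[ext] theorem ext {f g : Schwartz n} (h : ∀ x, f x = g x) : f = g := Subtype.ext (funext h)

@[simp] theorem add_apply (f g : Schwartz n) (x : Sph n) : (f + g) x = f x + g x := rfl
@[simp] theorem sub_apply (f g : Schwartz n) (x : Sph n) : (f - g) x = f x - g x := rfl
@[simp] theorem zero_apply (x : Sph n) : (0 : Schwartz n) x = 0 := rfl
@[simp] theorem smul_apply (c : ℂ) (f : Schwartz n) (x : Sph n) : (c • f) x = c * f x := rfl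

/-- A smooth function as a continuous function. -/
def toCont (n : ℕ) : Schwartz n →ₗ[ℂ] C(Sph n, ℂ) where
  toFun h := ⟨h, h.contMDiff.continuous⟩
  map_add' _ _ := rfl
  map_smul' _ _ := rfl

end Schwartz

/-- The extension of a function on the sphere to `ℝ ^ (n + 1)`, homogeneous of degree `0`
(with value `0` at the origin, which plays no role). -/
def sphExt {n : ℕ} (h : Sph n → ℂ) (x : EuclideanSpace ℝ (Fin (n + 1))) : ℂ :=
  open Classical in
  if hx : x = 0 then 0 else h ⟨‖x‖⁻¹ • x, by simp [norm_smul, hx]⟩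

theorem sphExt_coe {n : ℕ} (h : Sph n → ℂ) (x : Sph n) : sphExt h x = h x := by
  have hx : (x : EuclideanSpace ℝ (Fin (n + 1))) ≠ 0 := ne_zero_of_mem_unit_sphere x
  have hn : ‖(x : EuclideanSpace ℝ (Fin (n + 1)))‖ = 1 := by simp
  simp only [sphExt, hx, dite_false]
  congr 1
  ext1
  simp

theorem contDiffAt_sphExt {n : ℕ} {h : Sph n → ℂ} (hh : ContMDiff (𝓡 n) 𝓘(ℝ, ℂ) ∞ h)
    {x : EuclideanSpace ℝ (Fin (n + 1))} (hx : x ≠ 0) : ContDiffAt ℝ ∞ (sphExt h) x := by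
  have := Fact.mk (@finrank_euclideanSpace_fin ℝ _ (n + 1))
  let E := EuclideanSpace ℝ (Fin (n + 1))
  let U : TopologicalSpace.Opens E := ⟨{0}ᶜ, isOpen_compl_singleton⟩
  have hN : ContMDiff 𝓘(ℝ, E) 𝓘(ℝ, E) ∞ (fun y : U => ‖(y : E)‖⁻¹ • (y : E)) := by
    intro y
    have hy : (y : E) ≠ 0 := y.2
    have : ContDiffAt ℝ ∞ (fun z : E => ‖z‖⁻¹ • z) (y : E) :=
      ((contDiffAt_norm ℝ hy).inv (norm_ne_zero_iff.mpr hy)).smul contDiffAt_id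
    exact (contMDiffAt_subtype_iff (f := fun z : E => ‖z‖⁻¹ • z)).2 this.contMDiffAt
  have hmem : ∀ y : U, ‖(y : E)‖⁻¹ • (y : E) ∈ Metric.sphere (0 : E) 1 := by
    intro y
    have hy : (y : E) ≠ 0 := y.2
    simp [norm_smul, hy]
  have hc := hh.comp (hN.codRestrict_sphere hmem)
  have he : (h ∘ Set.codRestrict _ _ hmem) = fun y : U => sphExt h (y : E) := by
    funext y
    have hy : (y : E) ≠ 0 := y.2
    simp only [sphExt, hy, dite_false, Function.comp]
    rfl
  rw [he] at hc
  exact (contMDiffAt_subtype_iff.1 (hc ⟨x, hx⟩)).contDiffAt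

theorem contDiffAt_laplacian {n : ℕ} {F : EuclideanSpace ℝ (Fin (n + 1)) → ℂ}
    {x : EuclideanSpace ℝ (Fin (n + 1))} (hF : ContDiffAt ℝ ∞ F x) :
    ContDiffAt ℝ ∞ (Laplacian.laplacian F) x := by
  rw [InnerProductSpace.laplacian_eq_iteratedFDeriv_orthonormalBasis F
    (EuclideanSpace.basisFun (Fin (n + 1)) ℝ)]
  refine ContDiffAt.sum fun i _ => ?_
  have h2 : ContDiffAt ℝ ∞ (iteratedFDeriv ℝ 2 F) x := hF.iteratedFDeriv_right (i := 2) le_rfl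
  exact (ContinuousMultilinearMap.apply ℝ (fun _ : Fin 2 => EuclideanSpace ℝ (Fin (n + 1))) ℂ
    ![EuclideanSpace.basisFun (Fin (n + 1)) ℝ i,
      EuclideanSpace.basisFun (Fin (n + 1)) ℝ i]).contDiff.contDiffAt.comp x h2

/-- The Laplace-Beltrami operator of the sphere: the Euclidean Laplacian of the extension which is
homogeneous of degree `0` (i.e. does not depend on the radius), restricted to the sphere. -/
def sphLaplacian (n : ℕ) : Schwartz n →ₗ[ℂ] Schwartz n where
  toFun h := ⟨fun x => Laplacian.laplacian (sphExt h) x, by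
    have := Fact.mk (@finrank_euclideanSpace_fin ℝ _ (n + 1))
    intro x
    have hx : (x : EuclideanSpace ℝ (Fin (n + 1))) ≠ 0 := ne_zero_of_mem_unit_sphere x
    exact (contDiffAt_laplacian (contDiffAt_sphExt h.2 hx)).contMDiffAt.comp x
      (contMDiff_coe_sphere x)⟩
  map_add' f g := by
    ext x
    have hx : (x : EuclideanSpace ℝ (Fin (n + 1))) ≠ 0 := ne_zero_of_mem_unit_sphere x
    have he : sphExt (f + g : Schwartz n) = sphExt f + sphExt g := by
      funext y
      by_cases hy : y = 0 <;> simp [sphExt, hy]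
    change Laplacian.laplacian (sphExt (f + g : Schwartz n)) x = _
    rw [he, ContDiffAt.laplacian_add ((contDiffAt_sphExt f.2 hx).of_le (by norm_cast))
      ((contDiffAt_sphExt g.2 hx).of_le (by norm_cast))]
    rfl
  map_smul' c f := by
    ext x
    have hx : (x : EuclideanSpace ℝ (Fin (n + 1))) ≠ 0 := ne_zero_of_mem_unit_sphere x
    have he : sphExt (c • f : Schwartz n) =
        (ContinuousLinearMap.mul ℝ ℂ c) ∘ sphExt f := by
      funext y
      by_cases hy : y = 0 <;> simp [sphExt, hy]
    change Laplacian.laplacian (sphExt (c • f : Schwartz n)) x = _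
    rw [he, ContDiffAt.laplacian_CLM_comp_left ((contDiffAt_sphExt f.2 hx).of_le (by norm_cast))]
    rfl

/-- The norms `h ↦ ‖(Id - Δ) ^ k h‖_∞`, `k = 0, 1, 2, …`. -/
def sphSeminorms (n : ℕ) : SeminormFamily ℂ (Schwartz n) ℕ := fun k =>
  (normSeminorm ℂ C(Sph n, ℂ)).comp
    (Schwartz.toCont n ∘ₗ ((LinearMap.id - sphLaplacian n) ^ k : Schwartz n →ₗ[ℂ] Schwartz n))


/-- The topology of the Schwartz space, generated by the above norms. -/
instance (n : ℕ) : TopologicalSpace (Schwartz n) := (sphSeminorms n).moduleFilterBasis.topology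

theorem withSeminorms_schwartz (n : ℕ) : WithSeminorms (sphSeminorms n) := ⟨rfl⟩

instance (n : ℕ) : IsTopologicalAddGroup (Schwartz n) :=
  (withSeminorms_schwartz n).topologicalAddGroup

instance (n : ℕ) : ContinuousSMul ℂ (Schwartz n) := (withSeminorms_schwartz n).continuousSMul

/-- The space of distributions (generalised functions): the topological dual of the Schwartz
space. -/
abbrev SphDist (n : ℕ) : Type := Schwartz n →L[ℂ] ℂ

/-! ### Spherical harmonics and pseudo-differential operators -/

/-- Spherical harmonics of order `k`: `Δ Y = - k (k + d - 2) Y`, with `d = n + 1`. -/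
def sphHarm (n k : ℕ) : Submodule ℂ (Schwartz n) :=
  LinearMap.ker (sphLaplacian n - (-((k : ℂ) * ((k : ℂ) + (n : ℂ) - 1))) • LinearMap.id)

/-- `⟨f, g⟩ = ∫ f conj(g)` on the sphere. -/
def sphInner {n : ℕ} (f g : Schwartz n) : ℂ := ∫ x, f x * conj (g x) ∂(sphMeasure n)

/-- `Y₀, …, Y_{N-1}` is an orthonormal basis of the space of spherical harmonics of order `k`. -/
structure IsHarmONB {n : ℕ} (k : ℕ) {N : ℕ} (Y : Fin N → Schwartz n) : Prop where
  orthonormal : ∀ i j, sphInner (Y i) (Y j) = if i = j then 1 else 0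
  span_eq : Submodule.span ℂ (Set.range Y) = sphHarm n k

/-- `D` is the spherical pseudo-differential operator with Fourier symbol `a` and spectral growth
order `p`: a linear operator on the Schwartz space with
`D h = ∑ₖ aₖ ∑ₘ ⟨h, Yₖₘ⟩ Yₖₘ` (convergence in `L²`), whatever the orthonormal bases `Yₖₘ` of
spherical harmonics. -/
structure IsPseudoDiffOp {n : ℕ} (D : Schwartz n →ₗ[ℂ] Schwartz n) (a : ℕ → ℝ) (p : ℝ) :
    Prop where
  finite_zeros : {k | a k = 0}.Finite
  order_nonneg : 0 ≤ p
  growth : a =Θ[atTop] fun k : ℕ => (k : ℝ) ^ p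
  series : ∀ (N : ℕ → ℕ) (Y : ∀ k, Fin (N k) → Schwartz n), (∀ k, IsHarmONB k (Y k)) →
    ∀ h : Schwartz n, Tendsto (fun K : ℕ => ∫ x, ‖D h x -
      ∑ k ∈ Finset.range K, (a k : ℂ) * ∑ m, sphInner h (Y k m) * Y k m x‖ ^ 2 ∂(sphMeasure n))
      atTop (𝓝 0)

/-! ### Continuous functions and complex Borel measures as distributions -/

theorem integrable_sph {n : ℕ} {f : Sph n → ℂ} (hf : Continuous f) (μ : Measure (Sph n))
    [IsFiniteMeasure μ] : Integrable f μ :=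
  hf.integrable_of_hasCompactSupport (HasCompactSupport.of_compactSpace f)

theorem continuous_of_bound {n : ℕ} (L : Schwartz n →ₗ[ℂ] ℂ) (C : ℝ)
    (hL : ∀ φ, ‖L φ‖ ≤ C * ‖Schwartz.toCont n φ‖) : Continuous L := by
  have hp : Continuous (sphSeminorms n 0) := (withSeminorms_schwartz n).continuous_seminorm 0
  have h0 : ∀ φ, sphSeminorms n 0 φ = ‖Schwartz.toCont n φ‖ := fun φ => rfl
  refine continuous_of_continuousAt_zero L ?_
  rw [ContinuousAt, map_zero, tendsto_zero_iff_norm_tendsto_zero]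
  refine squeeze_zero (fun _ => norm_nonneg _) (fun φ => (hL φ).trans_eq (by rw [← h0])) ?_
  have : Tendsto (fun φ => C * sphSeminorms n 0 φ) (𝓝 (0 : Schwartz n))
      (𝓝 (C * sphSeminorms n 0 0)) := ((continuous_const (y := C)).mul hp).tendsto 0
  rwa [map_zero, mul_zero] at this

/-- The functional `φ ↦ ∫ η φ`. -/
def contFun {n : ℕ} (η : C(Sph n, ℂ)) : Schwartz n →ₗ[ℂ] ℂ where
  toFun φ := ∫ x, η x * φ x ∂(sphMeasure n)
  map_add' f g := by
    simp only [Schwartz.add_apply, mul_add]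
    exact integral_add (integrable_sph ((map_continuous η).mul f.contMDiff.continuous) _)
      (integrable_sph ((map_continuous η).mul g.contMDiff.continuous) _)
  map_smul' c f := by
    simp only [Schwartz.smul_apply, RingHom.id_apply, smul_eq_mul]
    rw [← integral_const_mul]
    exact integral_congr_ae (ae_of_all _ fun x => by ring)

theorem continuous_contFun {n : ℕ} (η : C(Sph n, ℂ)) : Continuous (contFun η) := by
  refine continuous_of_bound _ (‖η‖ * (sphMeasure n).real Set.univ) fun φ => ?_
  refine (norm_integral_le_of_norm_le_const (C := ‖η‖ * ‖Schwartz.toCont n φ‖)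
    (ae_of_all _ fun x => ?_)).trans_eq (by ring)
  rw [norm_mul]
  exact mul_le_mul (η.norm_coe_le_norm x) ((Schwartz.toCont n φ).norm_coe_le_norm x)
    (norm_nonneg _) (norm_nonneg _)

/-- A continuous function `η` as the distribution `φ ↦ ∫ η φ`. -/
def contDist (n : ℕ) : C(Sph n, ℂ) →ₗ[ℂ] SphDist n where
  toFun η := ⟨contFun η, continuous_contFun η⟩
  map_add' η θ := by
    ext φ
    change ∫ x, (η x + θ x) * φ x ∂(sphMeasure n) = _
    simp only [add_mul]
    exact integral_add (integrable_sph ((map_continuous η).mul φ.contMDiff.continuous) _)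
      (integrable_sph ((map_continuous θ).mul φ.contMDiff.continuous) _)
  map_smul' c η := by
    ext φ
    change ∫ x, (c * η x) * φ x ∂(sphMeasure n) = c * ∫ x, η x * φ x ∂(sphMeasure n)
    rw [← integral_const_mul]
    exact integral_congr_ae (ae_of_all _ fun x => by ring)

/-- `∫ η dμ` for a complex Borel measure `μ`. -/
def measPair {n : ℕ} (μ : ComplexMeasure (Sph n)) (η : C(Sph n, ℂ)) : ℂ :=
  μ.integral η (ContinuousLinearMap.mul ℝ ℂ)

theorem isFiniteMeasure_variation {n : ℕ} (μ : ComplexMeasure (Sph n)) :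
    IsFiniteMeasure μ.variation := by
  have h : μ.variation ≤ (ComplexMeasure.re μ).totalVariation +
      (ComplexMeasure.im μ).totalVariation := by
    refine VectorMeasure.variation_le_of_forall_enorm_le fun E hE => ?_
    have h1 := SignedMeasure.enorm_le_totalVariation (ComplexMeasure.re μ) E
    have h2 := SignedMeasure.enorm_le_totalVariation (ComplexMeasure.im μ) E
    refine le_trans ?_ (add_le_add h1 h2)
    simp only [ComplexMeasure.re_apply, ComplexMeasure.im_apply]
    simp only [enorm_eq_nnnorm]
    exact_mod_cast Complex.norm_le_abs_re_add_abs_im (μ E)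
  exact isFiniteMeasure_of_le _ h

instance {n : ℕ} (μ : ComplexMeasure (Sph n)) : IsFiniteMeasure μ.variation :=
  isFiniteMeasure_variation μ

/-- The total variation norm `|μ|(𝕊)`. -/
def tvNorm {n : ℕ} (μ : ComplexMeasure (Sph n)) : ℝ := (μ.variation Set.univ).toReal

theorem measPair_add_right {n : ℕ} (μ : ComplexMeasure (Sph n)) (η θ : C(Sph n, ℂ)) :
    measPair μ (η + θ) = measPair μ η + measPair μ θ :=
  VectorMeasure.integral_add (integrable_sph η.continuous _) (integrable_sph θ.continuous _)

theorem measPair_smul_right {n : ℕ} (μ : ComplexMeasure (Sph n)) (c : ℂ) (η : C(Sph n, ℂ)) :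
    measPair μ (c • η) = c * measPair μ η :=
  setToFun_smul (dominatedFinMeasAdditive_cbmApplyMeasure μ (ContinuousLinearMap.mul ℝ ℂ))
    (fun c s x => by
      change (c * x) * μ s = c * (x * μ s)
      ring) c η

theorem measPair_add_left {n : ℕ} (μ ν : ComplexMeasure (Sph n)) (η : C(Sph n, ℂ)) :
    measPair (μ + ν) η = measPair μ η + measPair ν η :=
  VectorMeasure.integral_add_vectorMeasure (integrable_sph η.continuous _)
    (integrable_sph η.continuous _)

theorem measPair_smul_left {n : ℕ} (c : ℂ) (μ : ComplexMeasure (Sph n)) (η : C(Sph n, ℂ)) :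
    measPair (c • μ) η = c * measPair μ η := by
  let B := ContinuousLinearMap.mul ℝ ℂ
  have hv : (c • μ).variation = ‖c‖₊ • μ.variation := VectorMeasure.variation_smul
  have hle : (c • μ).variation ≤ (‖c‖₊ : ENNReal) • μ.variation := le_of_eq hv
  have hT : DominatedFinMeasAdditive μ.variation ((c • μ).transpose B) (‖c‖ * ‖B‖) := by
    refine ⟨fun s t hs ht _ _ hd => cbmApplyMeasure_union (c • μ) B hs ht hd, fun s _ hsf => ?_⟩
    refine (norm_cbmApplyMeasure_le (c • μ) B s).trans ?_
    have h1 : ‖(c • μ) s‖ = ‖c‖ * ‖μ s‖ := norm_smul c (μ s)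
    rw [h1]
    calc ‖B‖ * (‖c‖ * ‖μ s‖) = ‖c‖ * ‖B‖ * ‖μ s‖ := by ring
      _ ≤ _ := by
        gcongr
        exact VectorMeasure.norm_measure_le_variation hsf.ne
  have hT₀ := dominatedFinMeasAdditive_cbmApplyMeasure μ B
  have hint : Integrable η μ.variation := integrable_sph η.continuous _
  have h1 : measPair (c • μ) η = setToFun μ.variation ((c • μ).transpose B) hT η :=
    (setToFun_congr_measure_of_integrable _ (by simp) hle hT
      (dominatedFinMeasAdditive_cbmApplyMeasure (c • μ) B) η hint).symm
  have h2 : ∀ f : Sph n → ℂ, Integrable f μ.variation →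
      setToFun μ.variation ((c • μ).transpose B) hT f =
        c * setToFun μ.variation (μ.transpose B) hT₀ f := by
    intro f hf
    refine Integrable.induction (P := fun f => setToFun μ.variation ((c • μ).transpose B) hT f =
        c * setToFun μ.variation (μ.transpose B) hT₀ f) ?_ ?_ ?_ ?_ hf
    · intro x s hs hsf
      rw [setToFun_indicator_const hT hs hsf.ne, setToFun_indicator_const hT₀ hs hsf.ne]
      change x * (c * μ s) = c * (x * μ s)
      ring
    · intro f g _ hf hg h h'
      rw [setToFun_add hT hf hg, setToFun_add hT₀ hf hg, h, h', mul_add]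
    · exact isClosed_eq (continuous_setToFun hT) (continuous_const.mul (continuous_setToFun hT₀))
    · intro f g hfg _ h
      rw [← setToFun_congr_ae hT hfg, ← setToFun_congr_ae hT₀ hfg, h]
  rw [h1, h2 η hint]
  rfl

/-- A complex Borel measure `μ` as the linear functional `φ ↦ ∫ φ dμ` on the Schwartz space. -/
def measFun (n : ℕ) : ComplexMeasure (Sph n) →ₗ[ℂ] Schwartz n →ₗ[ℂ] ℂ where
  toFun μ :=
    { toFun := fun φ => measPair μ (Schwartz.toCont n φ)
      map_add' := fun f g => by rw [map_add, measPair_add_right]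
      map_smul' := fun c f => by rw [map_smul, measPair_smul_right]; rfl }
  map_add' μ ν := LinearMap.ext fun φ => measPair_add_left μ ν _
  map_smul' c μ := LinearMap.ext fun φ => measPair_smul_left c μ _

theorem tvNorm_smul {n : ℕ} (c : ℂ) (μ : ComplexMeasure (Sph n)) :
    tvNorm (c • μ) = ‖c‖ * tvNorm μ := by
  simp [tvNorm, VectorMeasure.variation_smul]

theorem tvNorm_add_le {n : ℕ} (μ ν : ComplexMeasure (Sph n)) :
    tvNorm (μ + ν) ≤ tvNorm μ + tvNorm ν := by
  rw [tvNorm, tvNorm, tvNorm, ← ENNReal.toReal_add (measure_ne_top _ _) (measure_ne_top _ _)]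
  refine ENNReal.toReal_mono (by finiteness) ?_
  exact (VectorMeasure.variation_add_le (μ := μ) (ν := ν)) Set.univ

/-! ### Norms carried along a correspondence -/

/-- `inf q x` over the `x` which correspond to `v`. -/
def relNorm {V X : Type*} (R : V → X → Prop) (q : X → ℝ) (v : V) : ℝ := sInf (q '' {x | R v x})

theorem relNorm_core {V X : Type*} [AddCommGroup V] [Module ℂ V] [AddCommGroup X] [Module ℂ X]
    (R : V → X → Prop) (q : X → ℝ) (h0 : ∀ x, 0 ≤ q x)
    (hqs : ∀ (c : ℂ) x, q (c • x) = ‖c‖ * q x) (hqa : ∀ x y, q (x + y) ≤ q x + q y)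
    (hex : ∀ v, ∃ x, R v x) (hadd : ∀ v w x y, R v x → R w y → R (v + w) (x + y))
    (hsmul : ∀ (c : ℂ) v x, R v x → R (c • v) (c • x)) :
    @SeminormedSpace.Core ℂ V _ _ ⟨relNorm R q⟩ _ := by
  have hbdd : ∀ v, BddBelow (q '' {x | R v x}) := fun v => ⟨0, by rintro _ ⟨x, _, rfl⟩; exact h0 x⟩
  have hle : ∀ v x, R v x → relNorm R q v ≤ q x := fun v x h => csInf_le (hbdd v) ⟨x, h, rfl⟩
  have hge : ∀ v (b : ℝ), (∀ x, R v x → b ≤ q x) → b ≤ relNorm R q v := by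
    intro v b h
    obtain ⟨x, hx⟩ := hex v
    refine le_csInf ⟨q x, x, hx, rfl⟩ ?_
    rintro _ ⟨y, hy, rfl⟩
    exact h y hy
  have hsle : ∀ (c : ℂ) v, relNorm R q (c • v) ≤ ‖c‖ * relNorm R q v := by
    intro c v
    rcases eq_or_ne c 0 with rfl | hc
    · obtain ⟨x, hx⟩ := hex v
      refine (hle _ _ (hsmul 0 v x hx)).trans ?_
      rw [hqs]
      simp
    · have hcp : 0 < ‖c‖ := norm_pos_iff.mpr hc
      have : ‖c‖⁻¹ * relNorm R q (c • v) ≤ relNorm R q v := by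
        refine hge v _ fun x hx => ?_
        rw [inv_mul_le_iff₀ hcp, ← hqs]
        exact hle _ _ (hsmul c v x hx)
      rwa [inv_mul_le_iff₀ hcp] at this
  refine @SeminormedSpace.Core.mk ℂ V _ _ ⟨relNorm R q⟩ _ ?_ ?_ ?_
  · exact fun v => hge v 0 fun x _ => h0 x
  · intro c v
    refine le_antisymm (hsle c v) ?_
    rcases eq_or_ne c 0 with rfl | hc
    · simpa using hge _ 0 fun x _ => h0 x
    · have hcp : 0 < ‖c‖ := norm_pos_iff.mpr hc
      have h := hsle c⁻¹ (c • v)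
      rw [smul_smul, inv_mul_cancel₀ hc, one_smul, norm_inv] at h
      calc ‖c‖ * relNorm R q v ≤ ‖c‖ * (‖c‖⁻¹ * relNorm R q (c • v)) := by gcongr
        _ = relNorm R q (c • v) := by field_simp
  · intro v w
    have h1 : ∀ x, R v x → relNorm R q (v + w) - q x ≤ relNorm R q w := by
      intro x hx
      refine hge w _ fun y hy => ?_
      have := (hle _ _ (hadd v w x y hx hy)).trans (hqa x y)
      linarith
    have h2 : relNorm R q (v + w) - relNorm R q w ≤ relNorm R q v := by
      refine hge v _ fun x hx => ?_
      have := h1 x hx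
      linarith
    change relNorm R q (v + w) ≤ relNorm R q v + relNorm R q w
    linarith

/-! ### The spaces `C_D` and `M_D` -/

variable {n : ℕ}

/-- The action `f ↦ D f` of `D` on distributions, by duality: `⟨D f, φ⟩ = ⟨f, D φ⟩`. The result is
recorded as a linear functional on the Schwartz space; when it is a distribution, e.g. a
measure, this is said by an equality of linear functionals. -/
def distMap (D : Schwartz n →ₗ[ℂ] Schwartz n) : SphDist n →ₗ[ℂ] (Schwartz n →ₗ[ℂ] ℂ) where
  toFun f := (f : Schwartz n →ₗ[ℂ] ℂ) ∘ₗ D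
  map_add' _ _ := rfl
  map_smul' _ _ := rfl

/-- `h = D η` in the sense of distributions. -/
def IsImage (D : Schwartz n →ₗ[ℂ] Schwartz n) (h : SphDist n) (η : C(Sph n, ℂ)) : Prop :=
  (h : Schwartz n →ₗ[ℂ] ℂ) = distMap D (contDist n η)

/-- `D f = μ` in the sense of distributions. -/
def IsPrimitive (D : Schwartz n →ₗ[ℂ] Schwartz n) (f : SphDist n) (μ : ComplexMeasure (Sph n)) :
    Prop :=
  distMap D f = measFun n μ

/-- `C_D`: the distributions of the form `D η` with `η` continuous. -/
def cdSubmodule (D : Schwartz n →ₗ[ℂ] Schwartz n) : Submodule ℂ (SphDist n) where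
  carrier := {h | ∃ η, IsImage D h η}
  add_mem' := by
    rintro h k ⟨η, hη⟩ ⟨θ, hθ⟩
    refine ⟨η + θ, ?_⟩
    unfold IsImage at *
    rw [map_add, map_add, ← hη, ← hθ]
    rfl
  zero_mem' := ⟨0, by
    unfold IsImage
    rw [map_zero, map_zero]
    rfl⟩
  smul_mem' := by
    rintro c h ⟨η, hη⟩
    refine ⟨c • η, ?_⟩
    unfold IsImage at *
    rw [map_smul, map_smul, ← hη]
    rfl

/-- `M_D`: the distributions `f` such that `D f` is a complex Borel measure. -/
def mdSubmodule (D : Schwartz n →ₗ[ℂ] Schwartz n) : Submodule ℂ (SphDist n) where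
  carrier := {f | ∃ μ, IsPrimitive D f μ}
  add_mem' := by
    rintro f g ⟨μ, hμ⟩ ⟨ν, hν⟩
    refine ⟨μ + ν, ?_⟩
    unfold IsPrimitive at *
    rw [map_add, map_add, hμ, hν]
  zero_mem' := ⟨0, by unfold IsPrimitive; rw [map_zero, map_zero]⟩
  smul_mem' := by
    rintro c f ⟨μ, hμ⟩
    refine ⟨c • μ, ?_⟩
    unfold IsPrimitive at *
    rw [map_smul, map_smul, hμ]

/-- `C_D` as a type of its own (it gets its own norm, not the topology of distributions). -/
def CD (D : Schwartz n →ₗ[ℂ] Schwartz n) : Type := cdSubmodule D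

/-- `M_D` as a type of its own (it gets its own norm, not the topology of distributions). -/
def MD (D : Schwartz n →ₗ[ℂ] Schwartz n) : Type := mdSubmodule D

variable (D : Schwartz n →ₗ[ℂ] Schwartz n)

instance : AddCommGroup (CD D) := inferInstanceAs (AddCommGroup (cdSubmodule D))
instance : Module ℂ (CD D) := inferInstanceAs (Module ℂ (cdSubmodule D))
instance : AddCommGroup (MD D) := inferInstanceAs (AddCommGroup (mdSubmodule D))
instance : Module ℂ (MD D) := inferInstanceAs (Module ℂ (mdSubmodule D))

variable {D}

/-- An element of `C_D` as a distribution. -/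
def CD.toDist (h : CD D) : SphDist n := h.1

/-- An element of `M_D` as a distribution. -/
def MD.toDist (f : MD D) : SphDist n := f.1

variable (D)

/-- The norm of `h = D η` is the supremum norm of `η`. (The infimum over all such `η` is taken
because their uniqueness is not known for a general `D`.) -/
instance : Norm (CD D) := ⟨relNorm (fun h η => IsImage D (CD.toDist h) η) fun η => ‖η‖⟩

/-- The norm of `f` is the total variation of the measure `μ = D f`. (The infimum over all such
`μ` is taken because their uniqueness is not known a priori.) -/
instance : Norm (MD D) := ⟨relNorm (fun f μ => IsPrimitive D (MD.toDist f) μ) tvNorm⟩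

theorem cd_core : SeminormedSpace.Core ℂ (CD D) := by
  refine relNorm_core (fun (h : CD D) η => IsImage D (CD.toDist h) η) (fun η => ‖η‖)
    (fun η => norm_nonneg η) (fun c η => norm_smul c η) norm_add_le (fun h => h.2) ?_ ?_
  · intro h k η θ hη hθ
    unfold IsImage at *
    rw [map_add, map_add, ← hη, ← hθ]
    rfl
  · intro c h η hη
    unfold IsImage at *
    rw [map_smul, map_smul, ← hη]
    rfl

theorem md_core : SeminormedSpace.Core ℂ (MD D) := by
  refine relNorm_core (fun (f : MD D) μ => IsPrimitive D (MD.toDist f) μ) tvNorm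
    (fun μ => ENNReal.toReal_nonneg) tvNorm_smul tvNorm_add_le (fun f => f.2) ?_ ?_
  · intro f g μ ν hμ hν
    unfold IsPrimitive at *
    rw [map_add, ← hμ, ← hν]
    rfl
  · intro c f μ hμ
    unfold IsPrimitive at *
    rw [map_smul, ← hμ]
    rfl

instance : SeminormedAddCommGroup (CD D) := SeminormedAddCommGroup.ofCore (cd_core D)
instance : NormedSpace ℂ (CD D) := ⟨fun c h => ((cd_core D).norm_smul c h).le⟩
instance : SeminormedAddCommGroup (MD D) := SeminormedAddCommGroup.ofCore (md_core D)
instance : NormedSpace ℂ (MD D) := ⟨fun c f => ((md_core D).norm_smul c f).le⟩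

end

/-!
`D` acts on a spherical harmonic of order `k` as multiplication by `a k`, and injectivity makes
`a k` nonzero unless there are no spherical harmonics of order `k` but `0`. So everything rests on
the Fourier multipliers `h ↦ ∑ c_k P_k h` with `c` of polynomial growth, where `P_k` is the
orthogonal projection onto the spherical harmonics of order `k`. These map smooth functions to
continuous functions, and their supremum norm is bounded by one of the norms
`‖(Id - Δ) ^ j h‖_∞` (`exists_norm_multiplier_le`). Applied to `c = a` this shows that `D η` is a
distribution for `η` continuous. Applied to `c = a⁻¹` it gives a map `T` from the smooth functions
to `C(𝕊, ℂ)` with `T (D h) = h` (`IsPseudoDiffOp.exists_leftInverse`), so that `f = μ ∘ T` solves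
`D f = μ` for every complex measure `μ`. It is not needed that `T h` is smooth, nor that `D` is
surjective.

The bound on multipliers has three sources. First, `P_k` has supremum norm at most `N ^ 2`, with `N`
the dimension of the space of spherical harmonics of order `k`, because `∑ |Y_m x|²` is rotation
invariant, hence constant (`IsHarmONB.norm_sum_le`). Second, `N` is at most polynomial in `k`,
because every spherical harmonic of order `k` is the restriction of a polynomial of degree `k`
(`sphHarm_le_sphPoly`). Third, `(1 + λ_k) ^ j P_k h = P_k ((Id - Δ) ^ j h)` by Green's formula
(`integral_sphLaplacian_mul`), so that `P_k h` decreases rapidly in `k` (`norm_harmProj_decay`).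
Completeness of the spherical harmonics follows from the Stone-Weierstrass theorem
(`topologicalClosure_sphHarm_inf_sphPoly`), since powers of linear forms are sums of polynomial
eigenfunctions of `Δ` (`linPow_mem_iSup`). It implies that continuous functions and distributions
are determined by their values on spherical harmonics, which gives uniqueness of `η` and `f`.

By the Riesz representation theorem (`exists_measPair_eq`, with the norm identified in
`exists_lt_norm_measPair`), `μ ↦ ∫ · dμ` identifies complex measures, normed by total variation,
with the dual of `C(𝕊, ℂ)`. So `η ↦ D η` is an isometry from `C(𝕊, ℂ)` onto `C_D` (`cdEquiv`),
`μ ↦ μ ∘ T` is an isometry from the dual of `C(𝕊, ℂ)` onto `M_D` (`mdEquiv`), and the duality of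
`C_D` and `M_D` is that of `C(𝕊, ℂ)` and its dual, transported by these two isometries. For `φ`
smooth, `D (T φ) = φ` as distributions, because both sides agree on spherical harmonics; this
embeds the smooth functions in `C_D`, with `⟨f, φ⟩ = ∫ T φ dμ`.
-/

noncomputable section

/-! ### Real functionals on continuous functions and measures -/

section Jordan
open scoped NNReal CompactlySupported

variable {X : Type*} [TopologicalSpace X]

/-- The positive part of a functional `L` on `C(X, ℝ)`, evaluated at `f ≥ 0`: the supremum of
`L g` over `0 ≤ g ≤ f`. -/
def posPartFun (L : C(X, ℝ) → ℝ) (f : C(X, ℝ)) : ℝ := sSup (L '' Set.Icc 0 f)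

variable (L : C(X, ℝ) →L[ℝ] ℝ)

theorem posPartFun_le {f : C(X, ℝ)} (hf : 0 ≤ f) {b : ℝ}
    (h : ∀ g, 0 ≤ g → g ≤ f → L g ≤ b) : posPartFun L f ≤ b := by
  refine csSup_le ⟨L 0, 0, ⟨le_rfl, hf⟩, rfl⟩ ?_
  rintro _ ⟨g, ⟨h0, h1⟩, rfl⟩
  exact h g h0 h1

variable [CompactSpace X]

theorem posPartFun_bddAbove (f : C(X, ℝ)) : BddAbove (L '' Set.Icc 0 f) := by
  refine ⟨‖L‖ * ‖f‖, ?_⟩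
  rintro _ ⟨g, ⟨hg0, hgf⟩, rfl⟩
  refine (le_abs_self _).trans ((L.le_opNorm g).trans ?_)
  gcongr
  refine (ContinuousMap.norm_le _ (norm_nonneg _)).2 fun x => ?_
  have h0 : 0 ≤ g x := hg0 x
  rw [Real.norm_of_nonneg h0]
  exact (hgf x).trans ((le_abs_self _).trans (f.norm_coe_le_norm x))

theorem le_posPartFun {f g : C(X, ℝ)} (h0 : 0 ≤ g) (h : g ≤ f) : L g ≤ posPartFun L f :=
  le_csSup (posPartFun_bddAbove L f) ⟨g, ⟨h0, h⟩, rfl⟩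

theorem posPartFun_nonneg {f : C(X, ℝ)} (hf : 0 ≤ f) : 0 ≤ posPartFun L f := by
  simpa using le_posPartFun L le_rfl hf

theorem posPartFun_add {f h : C(X, ℝ)} (hf : 0 ≤ f) (hh : 0 ≤ h) :
    posPartFun L (f + h) = posPartFun L f + posPartFun L h := by
  refine le_antisymm (posPartFun_le L (add_nonneg hf hh) fun g h0 h1 => ?_) ?_
  · -- the Riesz decomposition `g = g ⊓ f + (g - g ⊓ f)`
    have hg : L g = L (g ⊓ f) + L (g - g ⊓ f) := by rw [← map_add, add_sub_cancel]
    rw [hg]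
    refine add_le_add (le_posPartFun L (le_inf h0 hf) inf_le_right)
      (le_posPartFun L (sub_nonneg.2 inf_le_left) fun x => ?_)
    have h2 : g x ≤ f x + h x := h1 x
    have h3 : 0 ≤ h x := hh x
    change g x - min (g x) (f x) ≤ h x
    rcases min_cases (g x) (f x) with h | h <;> rw [h.1] <;> linarith
  · have h1 : ∀ g, 0 ≤ g → g ≤ f → L g ≤ posPartFun L (f + h) - posPartFun L h := by
      intro g g0 gf
      have h2 : posPartFun L h ≤ posPartFun L (f + h) - L g := by
        refine posPartFun_le L hh fun k k0 kh => ?_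
        have := le_posPartFun L (add_nonneg g0 k0) (add_le_add gf kh)
        rw [map_add] at this
        linarith
      linarith
    have := posPartFun_le L hf h1
    linarith

theorem posPartFun_smul {f : C(X, ℝ)} (hf : 0 ≤ f) {c : ℝ} (hc : 0 ≤ c) :
    posPartFun L (c • f) = c * posPartFun L f := by
  have key : ∀ (c : ℝ), 0 < c → ∀ f : C(X, ℝ), 0 ≤ f →
      c * posPartFun L f ≤ posPartFun L (c • f) := by
    intro c hc f hf
    rw [← le_div_iff₀' hc]
    refine posPartFun_le L hf fun g g0 gf => ?_
    rw [le_div_iff₀' hc]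
    have := le_posPartFun L (smul_nonneg hc.le g0) (smul_le_smul_of_nonneg_left gf hc.le)
    rwa [map_smul, smul_eq_mul] at this
  rcases hc.eq_or_lt with rfl | hc
  · rw [zero_smul, zero_mul]
    refine le_antisymm (posPartFun_le L le_rfl fun g g0 g1 => ?_) (posPartFun_nonneg L le_rfl)
    rw [le_antisymm g1 g0, map_zero]
  · refine le_antisymm ?_ (key c hc f hf)
    have := key c⁻¹ (inv_pos.2 hc) (c • f) (smul_nonneg hc.le hf)
    rw [smul_smul, inv_mul_cancel₀ hc.ne', one_smul] at this
    rwa [inv_mul_le_iff₀ hc] at this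

/-- **Riesz representation** of real functionals: a bounded functional on `C(X, ℝ)` is the
difference of two finite measures. -/
theorem exists_measure_sub_measure [T2Space X] [MeasurableSpace X] [BorelSpace X] :
    ∃ μ ν : Measure X, IsFiniteMeasure μ ∧ IsFiniteMeasure ν ∧
      ∀ f : C(X, ℝ), L f = ∫ x, f x ∂μ - ∫ x, f x ∂ν := by
  let J : C_c(X, ℝ≥0) → C(X, ℝ) := fun f => ⟨fun x => (f x : ℝ), by fun_prop⟩
  have hJ0 : ∀ f, 0 ≤ J f := fun f x => (f x).2
  have hJadd : ∀ f g, J (f + g) = J f + J g := fun f g => by ext x; simp [J]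
  have hJsmul : ∀ (c : ℝ≥0) f, J (c • f) = (c : ℝ) • J f := fun c g => by ext x; simp [J]
  let P : C_c(X, ℝ≥0) →ₗ[ℝ≥0] ℝ≥0 :=
    { toFun := fun f => ⟨posPartFun L (J f), posPartFun_nonneg L (hJ0 f)⟩
      map_add' := fun f g => by
        refine NNReal.eq ?_
        change posPartFun L (J (f + g)) = posPartFun L (J f) + posPartFun L (J g)
        rw [hJadd, posPartFun_add L (hJ0 f) (hJ0 g)]
      map_smul' := fun c f => by
        refine NNReal.eq ?_
        change posPartFun L (J (c • f)) = c * posPartFun L (J f)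
        rw [hJsmul, posPartFun_smul L (hJ0 f) c.coe_nonneg] }
  let N : C_c(X, ℝ≥0) →ₗ[ℝ≥0] ℝ≥0 :=
    { toFun := fun f => ⟨posPartFun L (J f) - L (J f),
        sub_nonneg.2 (le_posPartFun L (hJ0 f) le_rfl)⟩
      map_add' := fun f g => by
        refine NNReal.eq ?_
        change posPartFun L (J (f + g)) - L (J (f + g)) =
          posPartFun L (J f) - L (J f) + (posPartFun L (J g) - L (J g))
        rw [hJadd, posPartFun_add L (hJ0 f) (hJ0 g), map_add]
        ring
      map_smul' := fun c f => by
        refine NNReal.eq ?_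
        change posPartFun L (J (c • f)) - L (J (c • f)) = c * (posPartFun L (J f) - L (J f))
        rw [hJsmul, posPartFun_smul L (hJ0 f) c.coe_nonneg, map_smul, smul_eq_mul]
        ring }
  have hfin : ∀ Λ : C_c(X, ℝ≥0) →ₗ[ℝ≥0] ℝ≥0, IsFiniteMeasure (NNRealRMK.rieszMeasure Λ) :=
    fun Λ => ⟨isCompact_univ.measure_lt_top⟩
  have := hfin P
  have := hfin N
  refine ⟨NNRealRMK.rieszMeasure P, NNRealRMK.rieszMeasure N, hfin P, hfin N, fun f => ?_⟩
  let Q : C(X, ℝ) → C_c(X, ℝ≥0) := fun g =>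
    ⟨⟨fun x => (g x).toNNReal, by fun_prop⟩, HasCompactSupport.of_compactSpace _⟩
  have hnonneg : ∀ g : C_c(X, ℝ≥0), L (J g) =
      ∫ x, J g x ∂(NNRealRMK.rieszMeasure P) - ∫ x, J g x ∂(NNRealRMK.rieszMeasure N) := by
    intro g
    have h1 : ∫ x, J g x ∂(NNRealRMK.rieszMeasure P) = P g := NNRealRMK.integral_rieszMeasure P g
    have h2 : ∫ x, J g x ∂(NNRealRMK.rieszMeasure N) = N g := NNRealRMK.integral_rieszMeasure N g
    rw [h1, h2]
    change _ = posPartFun L (J g) - (posPartFun L (J g) - L (J g))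
    ring
  have hf : f = J (Q f) - J (Q (-f)) := by
    ext x
    change f x = ((f x).toNNReal : ℝ) - ((-f x).toNNReal : ℝ)
    simp only [Real.coe_toNNReal']
    rcases max_cases (f x) 0 with h | h <;> rcases max_cases (-f x) 0 with h' | h' <;>
      rw [h.1, h'.1] <;> linarith
  have hint : ∀ (g : C(X, ℝ)) (μ : Measure X) [IsFiniteMeasure μ], Integrable g μ :=
    fun g μ _ => g.continuous.integrable_of_hasCompactSupport (HasCompactSupport.of_compactSpace _)
  have hsub : ∀ (μ : Measure X) [IsFiniteMeasure μ], ∫ x, f x ∂μ =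
      ∫ x, J (Q f) x ∂μ - ∫ x, J (Q (-f)) x ∂μ := by
    intro μ _
    rw [← integral_sub (hint _ _) (hint _ _)]
    conv_lhs => rw [hf]
    rfl
  rw [hsub, hsub]
  conv_lhs => rw [hf, map_sub, hnonneg, hnonneg]
  ring

end Jordan

/-! ### Complex measures as the dual of the continuous functions -/

section Riesz

variable {n : ℕ}

/-- A finite positive measure as a complex measure. -/
def complexOfMeasure (ν : Measure (Sph n)) [IsFiniteMeasure ν] : ComplexMeasure (Sph n) :=
  ν.toSignedMeasure.mapRange Complex.ofRealCLM.toLinearMap.toAddMonoidHom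
    Complex.ofRealCLM.continuous

theorem complexOfMeasure_apply (ν : Measure (Sph n)) [IsFiniteMeasure ν] {s : Set (Sph n)}
    (hs : MeasurableSet s) : complexOfMeasure ν s = (ν.real s : ℂ) := by
  simp [complexOfMeasure, VectorMeasure.mapRange_apply, Measure.toSignedMeasure_apply_measurable hs]

theorem measPair_complexOfMeasure (ν : Measure (Sph n)) [IsFiniteMeasure ν] (η : C(Sph n, ℂ)) :
    measPair (complexOfMeasure ν) η = ∫ x, η x ∂ν := by
  have hle : (complexOfMeasure ν).variation ≤ ν := by
    refine VectorMeasure.variation_le_of_forall_enorm_le fun E hE => ?_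
    rw [complexOfMeasure_apply ν hE, ← ofReal_norm, Complex.norm_real, Real.norm_of_nonneg
      measureReal_nonneg, ofReal_measureReal]
  rw [integral_eq_setToFun, measPair, VectorMeasure.integral_eq_setToFun]
  have hT : DominatedFinMeasAdditive ν ((complexOfMeasure ν).transpose
      (ContinuousLinearMap.mul ℝ ℂ)) 1 := by
    refine ⟨fun s t hs ht _ _ hd => cbmApplyMeasure_union (complexOfMeasure ν)
      (ContinuousLinearMap.mul ℝ ℂ) hs ht hd,
      fun s hs _ => ?_⟩
    refine (norm_cbmApplyMeasure_le _ (ContinuousLinearMap.mul ℝ ℂ) s).trans ?_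
    rw [complexOfMeasure_apply ν hs, Complex.norm_real, Real.norm_of_nonneg measureReal_nonneg]
    simp
  rw [← setToFun_congr_measure_of_integrable 1 (by simp) (by simpa using hle) hT
    (dominatedFinMeasAdditive_cbmApplyMeasure _ _) η (integrable_sph η.continuous _)]
  refine setToFun_congr_left' _ _ (fun s hs _ => ?_) _
  ext x
  change x * complexOfMeasure ν s = _
  rw [complexOfMeasure_apply ν hs, mul_comm]
  simp [weightedSMul]

/-- **Riesz representation theorem**: every bounded functional on `C(𝕊, ℂ)` is given by a complex
measure. -/
theorem exists_measPair_eq (L : C(Sph n, ℂ) →L[ℂ] ℂ) :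
    ∃ μ : ComplexMeasure (Sph n), ∀ η, measPair μ η = L η := by
  let I : C(Sph n, ℝ) →L[ℝ] C(Sph n, ℂ) := Complex.ofRealCLM.compLeftContinuous ℝ (Sph n)
  obtain ⟨μ₁, ν₁, _, _, h₁⟩ := exists_measure_sub_measure
    (Complex.reCLM ∘L (L.restrictScalars ℝ) ∘L I)
  obtain ⟨μ₂, ν₂, _, _, h₂⟩ := exists_measure_sub_measure
    (Complex.imCLM ∘L (L.restrictScalars ℝ) ∘L I)
  let μ : ComplexMeasure (Sph n) := (complexOfMeasure μ₁ + (-1 : ℂ) • complexOfMeasure ν₁) +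
    Complex.I • (complexOfMeasure μ₂ + (-1 : ℂ) • complexOfMeasure ν₂)
  have hreal : ∀ f : C(Sph n, ℝ), measPair μ (I f) = L (I f) := by
    intro f
    have e : ∀ (ν : Measure (Sph n)) [IsFiniteMeasure ν],
        measPair (complexOfMeasure ν) (I f) = ((∫ x, f x ∂ν : ℝ) : ℂ) := fun ν _ => by
      rw [measPair_complexOfMeasure]
      exact integral_ofReal
    have h₁ := h₁ f
    have h₂ := h₂ f
    simp only [μ, measPair_add_left, measPair_smul_left, e]
    rw [← Complex.re_add_im (L (I f))]
    change (L (I f)).re = _ at h₁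
    change (L (I f)).im = _ at h₂
    rw [h₁, h₂]
    push_cast
    ring
  refine ⟨μ, fun η => ?_⟩
  have hη : η = I (Complex.reCLM.compLeftContinuous ℝ (Sph n) η) +
      Complex.I • I (Complex.imCLM.compLeftContinuous ℝ (Sph n) η) := by
    ext x
    simpa [I, mul_comm] using (Complex.re_add_im (η x)).symm
  rw [hη, measPair_add_right, measPair_smul_right, hreal, hreal, map_add, map_smul, smul_eq_mul]

theorem norm_vectorIntegral_le (μ : ComplexMeasure (Sph n)) (f : Sph n → ℂ) :
    ‖μ.integral f (ContinuousLinearMap.mul ℝ ℂ)‖ ≤ ∫ x, ‖f x‖ ∂μ.variation := by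
  refine (VectorMeasure.norm_integral_le_integral_norm (μ := μ) (f := f)
    (B := ContinuousLinearMap.mul ℝ ℂ)).trans_eq ?_
  rw [ContinuousLinearMap.opNorm_mul, one_mul]

theorem norm_measPair_le (μ : ComplexMeasure (Sph n)) (η : C(Sph n, ℂ)) :
    ‖measPair μ η‖ ≤ tvNorm μ * ‖η‖ := by
  refine (norm_vectorIntegral_le μ η).trans ?_
  refine (integral_mono (integrable_sph η.continuous _).norm (integrable_const ‖η‖)
    fun x => η.norm_coe_le_norm x).trans ?_
  rw [integral_const, smul_eq_mul]
  rfl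

/-- The map of `ℂ` to its closed unit disc which is the identity there and radial outside. -/
def truncDisc (z : ℂ) : ℂ := ((max 1 ‖z‖)⁻¹ : ℝ) • z

theorem continuous_truncDisc : Continuous truncDisc := by
  refine Continuous.smul (Continuous.inv₀ (continuous_const.max continuous_norm) fun z => ?_)
    continuous_id
  positivity

theorem norm_truncDisc_le (z : ℂ) : ‖truncDisc z‖ ≤ 1 := by
  rw [truncDisc, norm_smul, norm_inv, Real.norm_of_nonneg (by positivity)]
  exact inv_mul_le_one_of_le₀ (le_max_right _ _) (by positivity)

/-- Truncation at most doubles the distance to a point of the unit disc. -/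
theorem norm_sub_truncDisc_le {w : ℂ} (hw : ‖w‖ ≤ 1) (z : ℂ) :
    ‖w - truncDisc z‖ ≤ 2 * ‖w - z‖ := by
  have h1 : ‖z - truncDisc z‖ ≤ ‖w - z‖ := by
    rcases le_total ‖z‖ 1 with hz | hz
    · simp [truncDisc, max_eq_left hz]
    · have h0 : 0 < ‖z‖ := by linarith
      have : z - truncDisc z = ((1 - ‖z‖⁻¹ : ℝ)) • z := by
        rw [truncDisc, max_eq_right hz, sub_smul, one_smul]
      rw [this, norm_smul, Real.norm_of_nonneg (sub_nonneg.2 (inv_le_one_of_one_le₀ hz)), sub_mul,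
        inv_mul_cancel₀ h0.ne', one_mul]
      have := norm_sub_norm_le z w
      rw [norm_sub_rev] at this
      linarith
  have h2 : w - truncDisc z = (w - z) + (z - truncDisc z) := by ring
  rw [h2]
  refine (norm_add_le _ _).trans ?_
  linarith

/-- The total variation is the norm of the functional on `C(𝕊, ℂ)`: simple functions of modulus at
most one nearly realise it, and they are limits in `L¹(|μ|)` of continuous functions, which can be
taken of modulus at most one. -/
theorem exists_lt_norm_measPair (μ : ComplexMeasure (Sph n)) {t : ℝ} (ht : t < tvNorm μ) :
    ∃ η : C(Sph n, ℂ), ‖η‖ ≤ 1 ∧ t < ‖measPair μ η‖ := by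
  rcases lt_or_ge t 0 with h0 | h0
  · exact ⟨0, by simp, h0.trans_le (norm_nonneg _)⟩
  have ht' : ENNReal.ofReal t < μ.variation Set.univ := by
    rwa [ENNReal.ofReal_lt_iff_lt_toReal h0 (measure_ne_top _ _)]
  obtain ⟨P, -, hdis, hmeas, hsum⟩ :=
    VectorMeasure.exists_lt_sum_of_lt_variation μ MeasurableSet.univ ht'
  have hT : t < ∑ p ∈ P, ‖μ p‖ := by
    have : ∑ p ∈ P, ‖μ p‖ₑ = ENNReal.ofReal (∑ p ∈ P, ‖μ p‖) := by
      rw [ENNReal.ofReal_sum_of_nonneg fun _ _ => norm_nonneg _]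
      exact Finset.sum_congr rfl fun p _ => (ofReal_norm _).symm
    rw [this] at hsum
    exact (ENNReal.ofReal_lt_ofReal_iff_of_nonneg h0).1 hsum
  set c : Set (Sph n) → ℂ := fun p => (‖μ p‖⁻¹ : ℝ) • conj (μ p) with hc
  have hcle : ∀ p, ‖c p‖ ≤ 1 := fun p => by
    rw [hc, norm_smul, norm_inv, norm_norm, RCLike.norm_conj]
    exact inv_mul_le_one
  have hcmul : ∀ p, c p * μ p = (‖μ p‖ : ℂ) := fun p => by
    rcases eq_or_ne (μ p) 0 with h | h
    · simp [h]
    · have : (‖μ p‖ : ℂ) ≠ 0 := by simpa using h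
      simp only [hc]
      rw [Complex.real_smul, mul_assoc, Complex.conj_mul']
      push_cast
      field_simp
  set f : Sph n → ℂ := fun x => ∑ p ∈ P, p.indicator (fun _ => c p) x with hf
  have hfle : ∀ x, ‖f x‖ ≤ 1 := by
    intro x
    by_cases hx : ∃ p ∈ P, x ∈ p
    · obtain ⟨p, hp, hxp⟩ := hx
      have : f x = c p := by
        rw [hf]
        refine (Finset.sum_eq_single_of_mem p hp fun q hq hqp => ?_).trans
          (Set.indicator_of_mem hxp _)
        exact Set.indicator_of_notMem
          (fun hxq => (Set.disjoint_left.1 (hdis hq hp hqp) hxq) hxp) _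
      rw [this]
      exact hcle p
    · push Not at hx
      have : f x = 0 := Finset.sum_eq_zero fun p hp => Set.indicator_of_notMem (hx p hp) _
      simp [this]
  have hint1 : ∀ p ∈ P, Integrable (p.indicator fun _ => c p) μ.variation := fun p hp =>
    (integrable_const _).indicator (hmeas p hp)
  have hint : Integrable f μ.variation := integrable_finsetSum P hint1
  have hI : μ.integral f (ContinuousLinearMap.mul ℝ ℂ) = ((∑ p ∈ P, ‖μ p‖ : ℝ) : ℂ) := by
    rw [hf, VectorMeasure.integral_finsetSum P hint1]
    push_cast
    refine Finset.sum_congr rfl fun p hp => ?_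
    rw [← hcmul, VectorMeasure.integral_eq_setToFun,
      setToFun_indicator_const _ (hmeas p hp) (measure_ne_top _ _)]
    rfl
  obtain ⟨g, -, hg, hgc, hgi⟩ := hint.exists_hasCompactSupport_integral_sub_le
    (ε := (∑ p ∈ P, ‖μ p‖ - t) / 3) (by linarith)
  let η : C(Sph n, ℂ) := ⟨fun x => truncDisc (g x), continuous_truncDisc.comp hgc⟩
  refine ⟨η, (ContinuousMap.norm_le _ zero_le_one).2 fun x => norm_truncDisc_le _, ?_⟩
  have hη : Integrable η μ.variation := integrable_sph η.continuous _
  have h1 : ‖μ.integral f (ContinuousLinearMap.mul ℝ ℂ) - measPair μ η‖ ≤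
      2 * ((∑ p ∈ P, ‖μ p‖ - t) / 3) := by
    rw [measPair, ← VectorMeasure.integral_sub hint hη]
    refine (norm_vectorIntegral_le _ _).trans ((integral_mono (hint.sub hη).norm
      ((hint.sub hgi).norm.const_mul 2) fun x => norm_sub_truncDisc_le (hfle x) _).trans ?_)
    rw [integral_const_mul]
    exact mul_le_mul_of_nonneg_left hg zero_le_two
  rw [hI] at h1
  have h2 := norm_sub_norm_le ((∑ p ∈ P, ‖μ p‖ : ℝ) : ℂ) (measPair μ η)
  rw [Complex.norm_real, Real.norm_of_nonneg (by linarith)] at h2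
  linarith

end Riesz

/-! ### Powers of linear forms and their Laplacians -/

section SecondDerivative

variable {E : Type*} [NormedAddCommGroup E] [NormedSpace ℝ E]

/-- The second derivative on the diagonal is the second derivative along a line. -/
theorem iteratedFDeriv_two_eq_of_hasDerivAt_line {f : E → ℝ} {x : E} (hf : ContDiffAt ℝ 2 f x)
    (e : E) {g : ℝ → ℝ} {c : ℝ}
    (h1 : ∀ᶠ s in 𝓝 (0 : ℝ), HasDerivAt (fun s => f (x + s • e)) (g s) s)
    (h2 : HasDerivAt g c 0) : iteratedFDeriv ℝ 2 f x ![e, e] = c := by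
  have hline : ∀ s : ℝ, HasDerivAt (fun s : ℝ => x + s • e) e s := fun s => by
    simpa using ((hasDerivAt_id s).smul_const e).const_add x
  have hdiff : ∀ᶠ y in 𝓝 x, DifferentiableAt ℝ f y := by
    have := hf.eventually (by simp)
    exact this.mono fun y hy => hy.differentiableAt (by simp)
  have hcont : Tendsto (fun s : ℝ => x + s • e) (𝓝 0) (𝓝 x) := by
    simpa using (hline 0).continuousAt.tendsto
  have h3 : ∀ᶠ s in 𝓝 (0 : ℝ), g s = fderiv ℝ f (x + s • e) e := by
    filter_upwards [h1, hcont.eventually hdiff] with s hs hd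
    exact hs.unique (hd.hasFDerivAt.comp_hasDerivAt s (hline s))
  have hd2 : DifferentiableAt ℝ (fderiv ℝ f) x :=
    (hf.fderiv_right (m := 1) (by norm_num)).differentiableAt (by simp)
  have h4 : HasDerivAt (fun s : ℝ => fderiv ℝ f (x + s • e)) (fderiv ℝ (fderiv ℝ f) x e) 0 := by
    have h0 : x + (0 : ℝ) • e = x := by simp
    have : HasFDerivAt (fderiv ℝ f) (fderiv ℝ (fderiv ℝ f) x) (x + (0 : ℝ) • e) := by
      rw [h0]
      exact hd2.hasFDerivAt
    exact this.comp_hasDerivAt (0 : ℝ) (hline 0)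
  have h5 : HasDerivAt (fun s : ℝ => fderiv ℝ f (x + s • e) e) (fderiv ℝ (fderiv ℝ f) x e e) 0 := by
    simpa using h4.clm_apply (hasDerivAt_const (0 : ℝ) e)
  rw [iteratedFDeriv_two_apply]
  exact (h5.congr_of_eventuallyEq h3).unique h2

end SecondDerivative

section LinearForms

variable {n : ℕ}

local notation "𝔼" n => EuclideanSpace ℝ (Fin (n + 1))

theorem Schwartz.sum_apply {ι : Type*} (s : Finset ι) (f : ι → Schwartz n) (x : Sph n) :
    (∑ i ∈ s, f i : Schwartz n) x = ∑ i ∈ s, f i x := by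
  classical
  induction s using Finset.induction_on with
  | empty => simp
  | insert a s ha ih => rw [Finset.sum_insert ha, Finset.sum_insert ha, Schwartz.add_apply, ih]

/-- The function `x ↦ ⟪v, x⟫ ^ m` on the sphere. -/
def linPow (v : 𝔼 n) (m : ℕ) : Schwartz n :=
  ⟨fun x => ((inner ℝ v (x : 𝔼 n) ^ m : ℝ) : ℂ), by
    have := Fact.mk (@finrank_euclideanSpace_fin ℝ _ (n + 1))
    have h : ContDiff ℝ ∞ (fun x : 𝔼 n => ((inner ℝ v x ^ m : ℝ) : ℂ)) :=
      Complex.ofRealCLM.contDiff.comp ((contDiff_const.inner ℝ contDiff_id).pow m)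
    exact h.contMDiff.comp contMDiff_coe_sphere⟩

theorem linPow_apply (v : 𝔼 n) (m : ℕ) (x : Sph n) :
    linPow v m x = ((inner ℝ v (x : 𝔼 n) ^ m : ℝ) : ℂ) := rfl

/-- The Laplacian, at the points of the sphere, of the homogeneous extension of `⟪v, x⟫ ^ m`. -/
theorem laplacian_inner_div_norm_pow (v : 𝔼 n) (m : ℕ) {x : 𝔼 n} (hx : ‖x‖ = 1) :
    Laplacian.laplacian (fun y : 𝔼 n => (inner ℝ v y * ‖y‖⁻¹) ^ m) x =
      m * (m - 1) * ‖v‖ ^ 2 * inner ℝ v x ^ (m - 2) - m * (m + n - 1) * inner ℝ v x ^ m := by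
  have hx0 : x ≠ 0 := by
    rintro rfl
    simp at hx
  have hcd : ContDiffAt ℝ 2 (fun y : 𝔼 n => (inner ℝ v y * ‖y‖⁻¹) ^ m) x :=
    ((contDiffAt_const.inner ℝ contDiffAt_id).mul
      ((contDiffAt_norm ℝ hx0).inv (norm_ne_zero_iff.mpr hx0))).pow m
  have key : ∀ e : 𝔼 n, ‖e‖ = 1 →
      iteratedFDeriv ℝ 2 (fun y : 𝔼 n => (inner ℝ v y * ‖y‖⁻¹) ^ m) x ![e, e] =
      m * (m - 1) * inner ℝ v x ^ (m - 2) * (inner ℝ v e - inner ℝ v x * inner ℝ x e) ^ 2 +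
      m * inner ℝ v x ^ (m - 1) * (-2 * (inner ℝ v e * inner ℝ x e) - inner ℝ v x
        + 3 * inner ℝ v x * inner ℝ x e ^ 2) := by
    intro e he
    set A := inner ℝ v x with hA
    set B := inner ℝ v e with hB
    set C := inner ℝ x e with hC
    -- `r s = ‖x + s e‖⁻¹`
    set r : ℝ → ℝ := fun s => ‖x + s • e‖⁻¹ with hr
    have hne : ∀ᶠ s in 𝓝 (0 : ℝ), x + s • e ≠ 0 := by
      have : Tendsto (fun s : ℝ => x + s • e) (𝓝 0) (𝓝 x) := by
        have : Continuous (fun s : ℝ => x + s • e) := by fun_prop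
        simpa using this.tendsto 0
      exact this.eventually (isOpen_compl_singleton.mem_nhds hx0)
    have hr' : ∀ s, x + s • e ≠ 0 → HasDerivAt r (-(C + s) * r s ^ 3) s := by
      intro s hs
      have hns : ‖x + s • e‖ ≠ 0 := norm_ne_zero_iff.2 hs
      have h1 : HasDerivAt (fun s : ℝ => x + s • e) e s := by
        simpa using ((hasDerivAt_id s).smul_const e).const_add x
      have h2 := h1.norm_sq
      have h3 := (h2.sqrt (by positivity)).inv (by positivity)
      have h4 : (fun s : ℝ => √(‖x + s • e‖ ^ 2))⁻¹ = r := by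
        funext t
        simp [hr, Real.sqrt_sq (norm_nonneg _)]
      rw [h4] at h3
      refine h3.congr_deriv ?_
      have h5 : inner ℝ (x + s • e) e = C + s := by
        rw [inner_add_left, inner_smul_left, real_inner_self_eq_norm_sq, he]
        simp [hC]
      rw [h5, Real.sqrt_sq (norm_nonneg _)]
      simp only [hr]
      field_simp
    have hlin : ∀ s, HasDerivAt (fun s : ℝ => A + s * B) B s := fun s => by
      simpa using ((hasDerivAt_id s).mul_const B).const_add A
    have hfun : (fun s : ℝ => (inner ℝ v (x + s • e) * ‖x + s • e‖⁻¹) ^ m) =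
        fun s => ((A + s * B) * r s) ^ m := by
      funext s
      rw [inner_add_right, inner_smul_right]
    have hr0 : r 0 = 1 := by simp [hr, hx]
    refine iteratedFDeriv_two_eq_of_hasDerivAt_line hcd e
      (g := fun s => m * ((A + s * B) * r s) ^ (m - 1) *
        (B * r s + (A + s * B) * (-(C + s) * r s ^ 3))) ?_ ?_
    · rw [hfun]
      filter_upwards [hne] with s hs
      exact ((hlin s).mul (hr' s hs)).pow m
    · have h0 : x + (0 : ℝ) • e ≠ 0 := by simpa using hx0
      have hr1 := hr' 0 h0
      have hl := hlin 0
      have hCs : HasDerivAt (fun s : ℝ => -(C + s)) (-1) 0 := by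
        exact ((hasDerivAt_id (0 : ℝ)).const_add C).neg
      have hp := (((hl.mul hr1).pow (m - 1)).const_mul (m : ℝ)).mul
        ((hr1.const_mul B).add (hl.mul (hCs.mul (hr1.pow 3))))
      refine hp.congr_deriv ?_
      simp only [Pi.mul_apply, Pi.pow_apply, Pi.add_apply, hr0]
      rcases m with _ | m
      · simp
      · simp only [Nat.add_sub_cancel, Nat.cast_add, Nat.cast_one]
        simp
        ring
  rw [InnerProductSpace.laplacian_eq_iteratedFDeriv_orthonormalBasis _
    (EuclideanSpace.basisFun (Fin (n + 1)) ℝ)]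
  simp only
  set b := EuclideanSpace.basisFun (Fin (n + 1)) ℝ with hb
  rw [Finset.sum_congr rfl fun i _ => key (b i) (b.norm_eq_one i)]
  have s1 : ∑ i, inner ℝ v (b i) ^ 2 = ‖v‖ ^ 2 := by
    rw [← b.sum_sq_norm_inner_left v]
    simp
  have s2 : ∑ i, inner ℝ x (b i) ^ 2 = 1 := by
    have := b.sum_sq_norm_inner_left x
    rw [hx, one_pow] at this
    simpa using this
  have s3 : ∑ i, inner ℝ v (b i) * inner ℝ x (b i) = inner ℝ v x := by
    rw [← b.sum_inner_mul_inner v x]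
    exact Finset.sum_congr rfl fun i _ => by rw [real_inner_comm x]
  have e1 : ∑ i, (inner ℝ v (b i) - inner ℝ v x * inner ℝ x (b i)) ^ 2 =
      ‖v‖ ^ 2 - inner ℝ v x ^ 2 := by
    have : ∀ i, (inner ℝ v (b i) - inner ℝ v x * inner ℝ x (b i)) ^ 2 =
        inner ℝ v (b i) ^ 2 - 2 * inner ℝ v x * (inner ℝ v (b i) * inner ℝ x (b i)) +
        inner ℝ v x ^ 2 * inner ℝ x (b i) ^ 2 := fun i => by ring
    simp only [this, Finset.sum_add_distrib, Finset.sum_sub_distrib, ← Finset.mul_sum, s1, s2, s3]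
    ring
  have e2 : ∑ i, (-2 * (inner ℝ v (b i) * inner ℝ x (b i)) - inner ℝ v x
        + 3 * inner ℝ v x * inner ℝ x (b i) ^ 2) = - n * inner ℝ v x := by
    simp only [Finset.sum_add_distrib, Finset.sum_sub_distrib, ← Finset.mul_sum, s2, s3]
    simp
    ring
  rw [Finset.sum_add_distrib, ← Finset.mul_sum, ← Finset.mul_sum, e1, e2]
  rcases m with _ | _ | m
  · simp
  · simp
  · simp only [show m + 1 + 1 - 1 = m + 1 by omega,
      show m + 1 + 1 - 2 = m by omega]
    push_cast
    ring

theorem sphLaplacian_linPow (v : 𝔼 n) (m : ℕ) :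
    sphLaplacian n (linPow v m) = ((m : ℂ) * (m - 1) * (‖v‖ : ℂ) ^ 2) • linPow v (m - 2) -
      ((m : ℂ) * (m + n - 1)) • linPow v m := by
  ext x
  have hx : ‖(x : 𝔼 n)‖ = 1 := by simp
  have hx0 : (x : 𝔼 n) ≠ 0 := ne_zero_of_mem_unit_sphere x
  change Laplacian.laplacian (sphExt (linPow v m)) x = _
  have h1 : sphExt (linPow v m) =ᶠ[𝓝 (x : 𝔼 n)]
      Complex.ofRealCLM ∘ fun y : 𝔼 n => (inner ℝ v y * ‖y‖⁻¹) ^ m := by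
    filter_upwards [isOpen_compl_singleton.mem_nhds hx0] with y hy
    have hy : y ≠ 0 := hy
    simp only [sphExt, hy, dite_false, linPow_apply, inner_smul_right, Function.comp,
      Complex.ofRealCLM_apply, mul_comm]
  have hcd : ContDiffAt ℝ 2 (fun y : 𝔼 n => (inner ℝ v y * ‖y‖⁻¹) ^ m) x :=
    ((contDiffAt_const.inner ℝ contDiffAt_id).mul
      ((contDiffAt_norm ℝ hx0).inv (norm_ne_zero_iff.mpr hx0))).pow m
  rw [(InnerProductSpace.laplacian_congr_nhds h1).eq_of_nhds, hcd.laplacian_CLM_comp_left,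
    Function.comp, laplacian_inner_div_norm_pow v m hx]
  simp only [Complex.ofRealCLM_apply, Schwartz.sub_apply, Schwartz.smul_apply, linPow_apply]
  push_cast
  ring

end LinearForms

/-! ### Polynomials on the sphere and density of the spherical harmonics -/

section Harmonics

variable {n : ℕ}

local notation "𝔼" n => EuclideanSpace ℝ (Fin (n + 1))

/-- The eigenvalue `k (k + d - 2)` of `-Δ`, with `d = n + 1`. -/
def sphEig (n k : ℕ) : ℝ := k * (k + n - 1)

theorem sphEig_strictMono (hn : 1 ≤ n) : StrictMono (sphEig n) := by
  refine strictMono_nat_of_lt_succ fun k => ?_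
  have : (1 : ℝ) ≤ n := by exact_mod_cast hn
  have hk : (0 : ℝ) ≤ k := k.cast_nonneg
  simp only [sphEig]
  push_cast
  nlinarith

theorem mem_sphHarm_iff {k : ℕ} {h : Schwartz n} :
    h ∈ sphHarm n k ↔ sphLaplacian n h = -(sphEig n k : ℂ) • h := by
  rw [sphHarm, LinearMap.mem_ker, LinearMap.sub_apply, sub_eq_zero, LinearMap.smul_apply,
    LinearMap.id_apply, sphEig]
  push_cast
  rfl

/-- The restrictions to the sphere of the polynomials of degree at most `m`, as the span of the
powers of linear forms. -/
def sphPoly (n m : ℕ) : Submodule ℂ (Schwartz n) :=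
  Submodule.span ℂ {h | ∃ (v : 𝔼 n) (j : ℕ), j ≤ m ∧ h = linPow v j}

theorem linPow_mem_sphPoly (v : 𝔼 n) {j m : ℕ} (h : j ≤ m) : linPow v j ∈ sphPoly n m :=
  Submodule.subset_span ⟨v, j, h, rfl⟩

theorem sphPoly_mono {j m : ℕ} (h : j ≤ m) : sphPoly n j ≤ sphPoly n m := by
  refine Submodule.span_mono ?_
  rintro _ ⟨v, i, hi, rfl⟩
  exact ⟨v, i, hi.trans h, rfl⟩

/-- Powers of linear forms are sums of polynomial eigenfunctions. On the powers of degree `m`, the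
operator `Δ + λ_m` lowers the degree by two, and it can be inverted on the eigenfunctions for
`λ_j`, `j < m`. -/
theorem linPow_mem_iSup (hn : 1 ≤ n) (v : 𝔼 n) (m : ℕ) :
    linPow v m ∈ ⨆ j, ⨆ (_ : j ≤ m), sphHarm n j ⊓ sphPoly n j := by
  induction m using Nat.strong_induction_on with
  | _ m ih =>
  set T : Schwartz n →ₗ[ℂ] Schwartz n := sphLaplacian n + (sphEig n m : ℂ) • LinearMap.id with hT
  set S : Submodule ℂ (Schwartz n) := ⨆ j, ⨆ (_ : j < m), sphHarm n j ⊓ sphPoly n j with hS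
  have hsurj : S ≤ S.map T := by
    refine iSup₂_le fun j hj q hq => ?_
    have hne : (sphEig n m : ℂ) - sphEig n j ≠ 0 := by
      rw [sub_ne_zero]
      exact_mod_cast (sphEig_strictMono hn hj).ne'
    have hqS : q ∈ S := Submodule.mem_iSup_of_mem j (Submodule.mem_iSup_of_mem hj hq)
    refine ⟨((sphEig n m : ℂ) - sphEig n j)⁻¹ • q, S.smul_mem _ hqS, ?_⟩
    rw [map_smul, hT, LinearMap.add_apply, mem_sphHarm_iff.1 hq.1, LinearMap.smul_apply,
      LinearMap.id_apply, ← add_smul, smul_smul, neg_add_eq_sub, inv_mul_cancel₀ hne, one_smul]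
  have hTp : T (linPow v m) ∈ S := by
    have h1 : T (linPow v m) = ((m : ℂ) * (m - 1) * (‖v‖ : ℂ) ^ 2) • linPow v (m - 2) := by
      rw [hT, LinearMap.add_apply, sphLaplacian_linPow, LinearMap.smul_apply, LinearMap.id_apply,
        sphEig]
      push_cast
      abel
    rw [h1]
    rcases m with _ | _ | m
    · simp
    · simp
    · refine S.smul_mem _ ?_
      have := ih m (by omega)
      refine (?_ : _ ≤ S) this
      exact iSup₂_le fun j hj => le_iSup₂_of_le j (by omega) le_rfl
  obtain ⟨r, hrS, hr⟩ := hsurj hTp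
  have hle : S ≤ ⨆ j, ⨆ (_ : j ≤ m), sphHarm n j ⊓ sphPoly n j :=
    iSup₂_le fun j hj => le_iSup₂_of_le j hj.le le_rfl
  have hSpoly : S ≤ sphPoly n m :=
    iSup₂_le fun j hj => inf_le_right.trans (sphPoly_mono hj.le)
  have hsub : linPow v m - r ∈ sphHarm n m ⊓ sphPoly n m := by
    refine ⟨?_, sub_mem (linPow_mem_sphPoly v le_rfl) (hSpoly hrS)⟩
    have h2 : T (linPow v m - r) = 0 := by rw [map_sub, hr, sub_self]
    rw [hT, LinearMap.add_apply, LinearMap.smul_apply, LinearMap.id_apply] at h2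
    refine mem_sphHarm_iff.2 ?_
    rw [neg_smul]
    exact eq_neg_of_add_eq_zero_left h2
  have : linPow v m = (linPow v m - r) + r := by abel
  rw [this]
  exact add_mem (Submodule.mem_iSup_of_mem m (Submodule.mem_iSup_of_mem le_rfl hsub)) (hle hrS)

/-- The monomial of exponent `α`, restricted to the sphere. -/
def sphMonomial (α : Fin (n + 1) → ℕ) : Schwartz n :=
  ⟨fun x => ((∏ i, (x : 𝔼 n) i ^ α i : ℝ) : ℂ), by
    have := Fact.mk (@finrank_euclideanSpace_fin ℝ _ (n + 1))
    have hp : ContDiff ℝ ∞ (fun x : 𝔼 n => ∏ i, x i ^ α i) :=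
      contDiff_prod fun i _ => by fun_prop
    have h : ContDiff ℝ ∞ (fun x : 𝔼 n => ((∏ i, x i ^ α i : ℝ) : ℂ)) :=
      Complex.ofRealCLM.contDiff.comp hp
    exact h.contMDiff.comp contMDiff_coe_sphere⟩

open Classical in
theorem sphPoly_le_span_monomial (m : ℕ) : sphPoly n m ≤ Submodule.span ℂ
    ((Finset.image (sphMonomial (n := n)) (Fintype.piFinset fun _ => Finset.range (m + 1)) :
      Finset (Schwartz n)) : Set (Schwartz n)) := by
  refine Submodule.span_le.2 ?_
  rintro _ ⟨v, j, hj, rfl⟩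
  have h : linPow v j = ∑ α ∈ Finset.piAntidiag Finset.univ j,
      ((Nat.multinomial Finset.univ α * ∏ i, v i ^ α i : ℝ) : ℂ) • sphMonomial α := by
    ext x
    have hin : inner ℝ v (x : 𝔼 n) = ∑ i, v i * (x : 𝔼 n) i := by
      simp [PiLp.inner_apply, mul_comm]
    rw [Schwartz.sum_apply, linPow_apply, hin, Finset.sum_pow_eq_sum_piAntidiag,
      Complex.ofReal_sum]
    refine Finset.sum_congr rfl fun α _ => ?_
    change _ = _ * ((∏ i, (x : 𝔼 n) i ^ α i : ℝ) : ℂ)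
    rw [← Complex.ofReal_mul, mul_assoc, ← Finset.prod_mul_distrib]
    simp only [mul_pow]
  rw [h]
  refine Submodule.sum_mem _ fun α hα => Submodule.smul_mem _ _ (Submodule.subset_span ?_)
  rw [Finset.mem_coe]
  refine Finset.mem_image_of_mem _ (Fintype.mem_piFinset.2 fun i => Finset.mem_range.2 ?_)
  have h1 : ∑ i, α i = j := (Finset.mem_piAntidiag.1 hα).1
  have h2 : α i ≤ ∑ i, α i := Finset.single_le_sum (fun _ _ => Nat.zero_le _) (Finset.mem_univ i)
  rw [h1] at h2
  omega

open Classical in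
instance (m : ℕ) : FiniteDimensional ℂ (sphPoly n m) :=
  have := FiniteDimensional.span_finset ℂ
    (Finset.image (sphMonomial (n := n)) (Fintype.piFinset fun _ => Finset.range (m + 1)))
  Submodule.finiteDimensional_of_le (sphPoly_le_span_monomial m)

open Classical in
theorem finrank_sphPoly_le (m : ℕ) : Module.finrank ℂ (sphPoly n m) ≤ (m + 1) ^ (n + 1) := by
  have := FiniteDimensional.span_finset ℂ
    (Finset.image (sphMonomial (n := n)) (Fintype.piFinset fun _ => Finset.range (m + 1)))
  refine (Submodule.finrank_mono (sphPoly_le_span_monomial m)).trans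
    ((finrank_span_finset_le_card _).trans (Finset.card_image_le.trans ?_))
  simp

/-- The span of the polynomial spherical harmonics is dense in `C(𝕊, ℂ)`, by the
Stone-Weierstrass theorem for the algebra spanned by the exponentials of linear forms. -/
theorem topologicalClosure_sphHarm_inf_sphPoly (hn : 1 ≤ n) :
    (⨆ k, (sphHarm n k ⊓ sphPoly n k).map (Schwartz.toCont n)).topologicalClosure = ⊤ := by
  set W := (⨆ k, (sphHarm n k ⊓ sphPoly n k).map (Schwartz.toCont n)).topologicalClosure with hW
  have hlin : ∀ v m, Schwartz.toCont n (linPow v m) ∈ W := by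
    intro v m
    refine Submodule.le_topologicalClosure _ ?_
    rw [← Submodule.map_iSup]
    exact Submodule.mem_map_of_mem
      ((iSup₂_le fun j _ => le_iSup (fun k => sphHarm n k ⊓ sphPoly n k) j :
        _ ≤ ⨆ k, sphHarm n k ⊓ sphPoly n k) (linPow_mem_iSup hn v m))
  let e : (𝔼 n) → C(Sph n, ℂ) := fun v => NormedSpace.exp (Schwartz.toCont n (linPow v 1))
  have he_apply : ∀ v x, e v x = Complex.exp ((inner ℝ v (x : 𝔼 n) : ℝ) : ℂ) := by
    intro v x
    let ev : C(Sph n, ℂ) →ₐ[ℂ] ℂ := ContinuousMap.evalAlgHom ℂ ℂ x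
    have := NormedSpace.map_exp ev (continuous_eval_const x)
      (Schwartz.toCont n (linPow v 1))
    change e v x = _ at this
    rw [this, ← Complex.exp_eq_exp_ℂ]
    change Complex.exp (((inner ℝ v (x : 𝔼 n)) ^ 1 : ℝ) : ℂ) = _
    rw [pow_one]
  have heW : ∀ v, e v ∈ W := by
    intro v
    have hs := NormedSpace.exp_series_hasSum_exp' (𝕂 := ℂ) (Schwartz.toCont n (linPow v 1))
    refine (Submodule.isClosed_topologicalClosure _).mem_of_tendsto hs
      (Eventually.of_forall fun s => Submodule.sum_mem _ fun m _ => Submodule.smul_mem _ _ ?_)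
    have : Schwartz.toCont n (linPow v 1) ^ m = Schwartz.toCont n (linPow v m) := by
      ext x
      change (((inner ℝ v (x : 𝔼 n)) ^ 1 : ℝ) : ℂ) ^ m = ((inner ℝ v (x : 𝔼 n) ^ m : ℝ) : ℂ)
      push_cast
      ring
    rw [this]
    exact hlin v m
  let M : Submonoid C(Sph n, ℂ) :=
    { carrier := Set.range e
      one_mem' := ⟨0, by ext x; simp [he_apply]⟩
      mul_mem' := by
        rintro _ _ ⟨v, rfl⟩ ⟨w, rfl⟩
        exact ⟨v + w, by ext x; simp [he_apply, inner_add_left, Complex.exp_add]⟩ }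
  have hstar : star (M : Set C(Sph n, ℂ)) = M := by
    have : ∀ v, star (e v) = e v := fun v => by
      ext x
      rw [ContinuousMap.star_apply, he_apply, ← Complex.ofReal_exp]
      exact Complex.conj_ofReal _
    ext f
    constructor
    · rintro ⟨v, hv⟩
      exact ⟨v, by rw [← this, hv, star_star]⟩
    · rintro ⟨v, rfl⟩
      exact ⟨v, (this v).symm⟩
  let A := StarAlgebra.adjoin ℂ (M : Set C(Sph n, ℂ))
  have hA : (A : Set C(Sph n, ℂ)) ⊆ W := by
    intro f hf
    have hf' : f ∈ Algebra.adjoin ℂ (M : Set C(Sph n, ℂ)) := by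
      have : f ∈ A.toSubalgebra := hf
      rwa [StarAlgebra.adjoin_toSubalgebra, hstar, Set.union_self] at this
    have h2 : f ∈ Submodule.span ℂ (M : Set C(Sph n, ℂ)) := by
      have h3 := Algebra.adjoin_eq_span ℂ (M : Set C(Sph n, ℂ))
      rw [Submonoid.closure_eq] at h3
      rw [← h3]
      exact hf'
    refine (Submodule.span_le.2 ?_ : _ ≤ W) h2
    rintro _ ⟨v, rfl⟩
    exact heW v
  have hsep : A.SeparatesPoints := by
    intro x y hxy
    refine ⟨e ((x : 𝔼 n) - y), ⟨_, StarAlgebra.subset_adjoin ℂ _ ⟨_, rfl⟩, rfl⟩, ?_⟩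
    rw [he_apply, he_apply, ← Complex.ofReal_exp, ← Complex.ofReal_exp]
    intro h
    have h1 := Real.exp_injective (Complex.ofReal_injective h)
    rw [← sub_eq_zero, ← inner_sub_right, inner_self_eq_zero, sub_eq_zero] at h1
    exact hxy (Subtype.ext h1)
  have htop := ContinuousMap.starSubalgebra_topologicalClosure_eq_top_of_separatesPoints A hsep
  refine eq_top_iff.2 fun f _ => ?_
  have hf : f ∈ A.topologicalClosure := by rw [htop]; trivial
  have hf : f ∈ closure (A : Set C(Sph n, ℂ)) := hf
  exact closure_minimal hA (Submodule.isClosed_topologicalClosure _) hf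

end Harmonics

/-! ### Green's formula on the sphere -/

section Green

variable {n : ℕ}

local notation "𝔼" n => EuclideanSpace ℝ (Fin (n + 1))

/-- Integration in polar coordinates of the product of an angular and a radial function. -/
theorem integral_sphExt_mul_norm (A : Sph n → ℂ) (B : ℝ → ℂ) :
    ∫ x : 𝔼 n, sphExt A x * B ‖x‖ =
      (∫ x, A x ∂(sphMeasure n)) * ∫ r : Set.Ioi (0 : ℝ), B r ∂(Measure.volumeIoiPow n) := by
  calc ∫ x : 𝔼 n, sphExt A x * B ‖x‖
      = ∫ x : ({0}ᶜ : Set (𝔼 n)), sphExt A x * B ‖(x : 𝔼 n)‖ ∂(volume.comap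
          Subtype.val) := by
        rw [integral_subtype_comap (measurableSet_singleton _).compl
          fun x : 𝔼 n => sphExt A x * B ‖x‖, restrict_compl_singleton]
    _ = ∫ z, A z.1 * B z.2 ∂((sphMeasure n).prod (Measure.volumeIoiPow n)) := by
        have h := (volume : Measure (𝔼 n)).measurePreserving_homeomorphUnitSphereProd.integral_comp
          (Homeomorph.measurableEmbedding _) (fun z => A z.1 * B z.2)
        rw [finrank_euclideanSpace_fin, Nat.add_sub_cancel] at h
        rw [← h]
        refine integral_congr_ae (ae_of_all _ fun x => ?_)
        have hx : (x : 𝔼 n) ≠ 0 := x.2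
        simp only [sphExt, hx, dite_false]
        congr 1
        · congr 1
          ext1
          simp
        · simp
    _ = _ := integral_prod_mul A fun r : Set.Ioi (0 : ℝ) => B r

/-- A smooth radial cut-off function supported in a spherical shell. -/
def shellBump : ContDiffBump (2 : ℝ) := ⟨1 / 2, 1, by norm_num, by norm_num⟩

/-- The cut-off `x ↦ ψ (‖x‖ ^ 2)`, with values in `ℂ`. -/
def shellFun (n : ℕ) (x : 𝔼 n) : ℂ := ((shellBump (‖x‖ ^ 2) : ℝ) : ℂ)

theorem contDiff_shellFun : ContDiff ℝ ∞ (shellFun n) :=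
  Complex.ofRealCLM.contDiff.comp (shellBump.contDiff.comp (contDiff_norm_sq ℝ))

theorem shellFun_eq_zero_of_norm_le {x : 𝔼 n} (hx : ‖x‖ ≤ 1) : shellFun n x = 0 := by
  have h : shellBump (‖x‖ ^ 2) = 0 := by
    refine shellBump.zero_of_le_dist ?_
    rw [Real.dist_eq, abs_sub_comm]
    refine le_trans ?_ (le_abs_self _)
    change (1 : ℝ) ≤ _
    nlinarith [norm_nonneg x]
  rw [shellFun, h, Complex.ofReal_zero]

theorem hasCompactSupport_shellFun : HasCompactSupport (shellFun n) := by
  refine HasCompactSupport.intro (isCompact_closedBall (0 : 𝔼 n) 2) fun x hx => ?_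
  have hx : 2 < ‖x‖ := by simpa using hx
  have h : shellBump (‖x‖ ^ 2) = 0 := by
    refine shellBump.zero_of_le_dist ?_
    rw [Real.dist_eq]
    refine le_trans ?_ (le_abs_self _)
    change (1 : ℝ) ≤ _
    nlinarith [norm_nonneg x]
  rw [shellFun, h, Complex.ofReal_zero]

theorem shellFun_eventually_zero : ∀ᶠ x in 𝓝 (0 : 𝔼 n), shellFun n x = 0 := by
  filter_upwards [Metric.ball_mem_nhds (0 : 𝔼 n) one_pos] with x hx
  exact shellFun_eq_zero_of_norm_le (by simpa using (Metric.mem_ball.1 hx).le)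

/-- The integral over `ℝ ^ (n + 1)` of a directional derivative vanishes. -/
theorem integral_fderiv_apply_eq_zero {W : (𝔼 n) → ℂ} (hW : ContDiff ℝ 1 W)
    (hc : HasCompactSupport W) (e : 𝔼 n) : ∫ x, fderiv ℝ W x e = 0 := by
  have h := integral_mul_fderiv_eq_neg_fderiv_mul_of_integrable (μ := (volume : Measure (𝔼 n)))
    (f := fun _ => (1 : ℂ)) (g := W) (v := e) (by simp) ?_ ?_ (fun _ _ => by fun_prop)
    (fun x _ => hW.differentiable (by norm_num) x)
  · simpa using h
  · simp only [one_mul]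
    refine ((hW.continuous_fderiv (by norm_num)).clm_apply
      continuous_const).integrable_of_hasCompactSupport ?_
    exact hc.fderiv_apply (𝕜 := ℝ) e
  · simp only [one_mul]
    exact hW.continuous.integrable_of_hasCompactSupport hc

theorem sphExt_smul (h : Sph n → ℂ) {c : ℝ} (hc : 0 < c) (x : 𝔼 n) :
    sphExt h (c • x) = sphExt h x := by
  by_cases hx : x = 0
  · simp [hx]
  · have hcx : c • x ≠ 0 := smul_ne_zero hc.ne' hx
    simp only [sphExt, hx, hcx, dite_false]
    congr 2
    rw [norm_smul, Real.norm_of_nonneg hc.le, mul_inv, smul_smul, mul_right_comm,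
      inv_mul_cancel₀ hc.ne', one_mul]

/-- Euler's identity in degree `0`. -/
theorem fderiv_sphExt_self {h : Sph n → ℂ} (hh : ContMDiff (𝓡 n) 𝓘(ℝ, ℂ) ∞ h) {x : 𝔼 n}
    (hx : x ≠ 0) : fderiv ℝ (sphExt h) x x = 0 := by
  have hd : DifferentiableAt ℝ (sphExt h) ((1 : ℝ) • x) := by
    rw [one_smul]
    exact (contDiffAt_sphExt hh hx).differentiableAt (by simp)
  have h1 : HasDerivAt (fun c : ℝ => c • x) x 1 := by
    simpa using (hasDerivAt_id (1 : ℝ)).smul_const x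
  have h2 := hd.hasFDerivAt.comp_hasDerivAt (1 : ℝ) h1
  rw [one_smul] at h2
  refine h2.unique ((hasDerivAt_const (1 : ℝ) (sphExt h x)).congr_of_eventuallyEq ?_)
  filter_upwards [lt_mem_nhds one_pos] with c hc
  exact sphExt_smul h hc x

theorem laplacian_sphExt_smul (h : Sph n → ℂ) {c : ℝ} (hc : 0 < c) (x : 𝔼 n) :
    (c : ℂ) ^ 2 * Laplacian.laplacian (sphExt h) (c • x) = Laplacian.laplacian (sphExt h) x := by
  have hf : (fun y => sphExt h (c • y)) = sphExt h := funext fun y => sphExt_smul h hc y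
  have h1 : fderiv ℝ (sphExt h) = fun y => c • fderiv ℝ (sphExt h) (c • y) := by
    funext y
    conv_lhs => rw [← hf]
    exact fderiv_comp_smul c
  have h2 : fderiv ℝ (fderiv ℝ (sphExt h)) x =
      c • c • fderiv ℝ (fderiv ℝ (sphExt h)) (c • x) := by
    have := invertibleOfNonzero hc.ne'
    conv_lhs => rw [h1]
    rw [← fderiv_comp_smul (f := fderiv ℝ (sphExt h)) c]
    exact fderiv_const_smul_of_invertible (f := fun y => fderiv ℝ (sphExt h) (c • y)) c
  rw [InnerProductSpace.laplacian_eq_iteratedFDeriv_orthonormalBasis _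
    (EuclideanSpace.basisFun (Fin (n + 1)) ℝ)]
  simp only [iteratedFDeriv_two_apply, h2, Finset.mul_sum]
  refine Finset.sum_congr rfl fun i _ => ?_
  simp only [FunLike.coe_smul, Pi.smul_apply, Complex.real_smul]
  ring

/-- The Laplacian of the extension of degree `0` is the extension of degree `-2` of `Δ h`. -/
theorem laplacian_sphExt_eq (h : Schwartz n) {x : 𝔼 n} (hx : x ≠ 0) :
    Laplacian.laplacian (sphExt h) x = sphExt (sphLaplacian n h) x * (((‖x‖ ^ 2)⁻¹ : ℝ) : ℂ) := by
  have h1 := laplacian_sphExt_smul (h : Sph n → ℂ) (inv_pos.2 (norm_pos_iff.2 hx)) x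
  rw [← h1]
  simp only [sphExt, hx, dite_false]
  change _ = Laplacian.laplacian (sphExt h) (‖x‖⁻¹ • x) * _
  push_cast
  ring

/-- The radial factor of the integral over `ℝ ^ (n + 1)` of an angular function times the cut-off is
not zero. Hence identities between integrals over the sphere can be read off from integrals over
`ℝ ^ (n + 1)`. -/
theorem radial_integral_ne_zero (n : ℕ) :
    ∫ r : Set.Ioi (0 : ℝ), ((shellBump (r.1 ^ 2) : ℝ) : ℂ) * (((r.1 ^ 2)⁻¹ : ℝ) : ℂ)
      ∂(Measure.volumeIoiPow n) ≠ 0 := by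
  have h := integral_sphExt_mul_norm (n := n) (fun _ => 1)
    (fun r => ((shellBump (r ^ 2) : ℝ) : ℂ) * (((r ^ 2)⁻¹ : ℝ) : ℂ))
  intro h0
  rw [h0, mul_zero] at h
  have h1 : ∀ x : 𝔼 n, sphExt (fun _ : Sph n => (1 : ℂ)) x *
      (((shellBump (‖x‖ ^ 2) : ℝ) : ℂ) * (((‖x‖ ^ 2)⁻¹ : ℝ) : ℂ)) =
      ((shellBump (‖x‖ ^ 2) * (‖x‖ ^ 2)⁻¹ : ℝ) : ℂ) := by
    intro x
    by_cases hx : x = 0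
    · simp [hx]
    · simp [sphExt, hx]
  simp only [h1] at h
  rw [integral_complex_ofReal, Complex.ofReal_eq_zero] at h
  refine absurd h (ne_of_gt ?_)
  have hz : ∀ᶠ x in 𝓝 (0 : 𝔼 n), shellBump (‖x‖ ^ 2) * (‖x‖ ^ 2)⁻¹ = 0 := by
    filter_upwards [shellFun_eventually_zero (n := n)] with x hx
    have : shellBump (‖x‖ ^ 2) = 0 := Complex.ofReal_eq_zero.1 hx
    rw [this, zero_mul]
  obtain ⟨x, hx⟩ := exists_norm_eq (𝔼 n) (Real.sqrt_nonneg 2)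
  have hx2 : ‖x‖ ^ 2 = 2 := by rw [hx, Real.sq_sqrt zero_le_two]
  refine Continuous.integral_pos_of_hasCompactSupport_nonneg_nonzero (x := x) ?_ ?_ ?_ ?_
  · refine continuous_iff_continuousAt.2 fun y => ?_
    by_cases hy : y = 0
    · rw [hy]
      exact (continuousAt_const (y := (0 : ℝ))).congr (hz.mono fun _ h => h.symm)
    · exact ((shellBump.continuous.comp (by fun_prop)).continuousAt).mul
        ((by fun_prop : Continuous fun y : 𝔼 n => ‖y‖ ^ 2).continuousAt.inv₀ (by simpa using hy))
  · refine (hasCompactSupport_shellFun (n := n)).mono fun y hy => ?_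
    rw [Function.mem_support] at hy ⊢
    rw [shellFun]
    exact_mod_cast left_ne_zero_of_mul hy
  · exact fun y => mul_nonneg shellBump.nonneg (by positivity)
  · rw [hx2, shellBump.one_of_mem_closedBall (by simp [shellBump])]
    norm_num

/-- **Green's formula** on the sphere: the Laplace-Beltrami operator is symmetric. It follows from
the divergence theorem for the field `χ (g ∇f - f ∇g)` on `ℝ ^ (n + 1)`, with `f`, `g` homogeneous
of degree `0` and `χ` a radial cut-off: the term with `∇χ` vanishes, by Euler's identity. -/
theorem integral_sphLaplacian_mul (f g : Schwartz n) :
    ∫ x, sphLaplacian n f x * g x ∂(sphMeasure n) =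
      ∫ x, f x * sphLaplacian n g x ∂(sphMeasure n) := by
  set F := sphExt (f : Sph n → ℂ) with hF
  set G := sphExt (g : Sph n → ℂ) with hG
  set b := EuclideanSpace.basisFun (Fin (n + 1)) ℝ with hb
  let W : Fin (n + 1) → (𝔼 n) → ℂ := fun i y =>
    shellFun n y * (G y * fderiv ℝ F y (b i) - F y * fderiv ℝ G y (b i))
  have hW : ∀ i, ContDiff ℝ 1 (W i) := by
    intro i
    refine contDiff_iff_contDiffAt.2 fun y => ?_
    by_cases hy : y = 0
    · refine (contDiffAt_const (c := (0 : ℂ))).congr_of_eventuallyEq ?_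
      rw [hy]
      filter_upwards [shellFun_eventually_zero (n := n)] with z hz
      simp only [W, hz, zero_mul]
    · have hFy := contDiffAt_sphExt f.contMDiff hy
      have hGy := contDiffAt_sphExt g.contMDiff hy
      have hF1 : ContDiffAt ℝ 1 (fun y => fderiv ℝ F y (b i)) y :=
        ((hFy.of_le (by norm_cast)).fderiv_right (m := 1) le_rfl).clm_apply contDiffAt_const
      have hG1 : ContDiffAt ℝ 1 (fun y => fderiv ℝ G y (b i)) y :=
        ((hGy.of_le (by norm_cast)).fderiv_right (m := 1) le_rfl).clm_apply contDiffAt_const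
      exact ((contDiff_shellFun (n := n)).contDiffAt.of_le (by norm_cast)).mul
        (((hGy.of_le (by norm_cast)).mul hF1).sub ((hFy.of_le (by norm_cast)).mul hG1))
  have hWc : ∀ i, HasCompactSupport (W i) := fun i =>
    (hasCompactSupport_shellFun (n := n)).mul_right
  have hdiv : ∫ y, ∑ i, fderiv ℝ (W i) y (b i) = 0 := by
    rw [integral_finsetSum]
    · exact Finset.sum_eq_zero fun i _ => integral_fderiv_apply_eq_zero (hW i) (hWc i) (b i)
    · intro i _
      exact (((hW i).continuous_fderiv (by norm_num)).clm_apply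
        continuous_const).integrable_of_hasCompactSupport ((hWc i).fderiv_apply (𝕜 := ℝ) (b i))
  let u : Sph n → ℂ := fun x => sphLaplacian n f x * g x - f x * sphLaplacian n g x
  have hpt : ∀ y : 𝔼 n, y ≠ 0 → ∑ i, fderiv ℝ (W i) y (b i) =
      sphExt u y * (((shellBump (‖y‖ ^ 2) : ℝ) : ℂ) * (((‖y‖ ^ 2)⁻¹ : ℝ) : ℂ)) := by
    intro y hy
    have hFy : ContDiffAt ℝ ∞ F y := contDiffAt_sphExt f.contMDiff hy
    have hGy : ContDiffAt ℝ ∞ G y := contDiffAt_sphExt g.contMDiff hy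
    have hdF := (hFy.differentiableAt (by simp)).hasFDerivAt
    have hdG := (hGy.differentiableAt (by simp)).hasFDerivAt
    have hdF2 := ((hFy.fderiv_right (m := 1) (by norm_cast)).differentiableAt
      (by simp)).hasFDerivAt
    have hdG2 := ((hGy.fderiv_right (m := 1) (by norm_cast)).differentiableAt
      (by simp)).hasFDerivAt
    have hχ : HasFDerivAt (shellFun n) (((deriv shellBump (‖y‖ ^ 2) * 2 : ℝ) : ℂ) •
        Complex.ofRealCLM ∘L innerSL ℝ y) y := by
      have h1 : HasDerivAt shellBump (deriv shellBump (‖y‖ ^ 2)) (‖y‖ ^ 2) :=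
        (shellBump.contDiff.differentiable (n := 1) (by norm_num) _).hasDerivAt
      have h2 := h1.comp_hasFDerivAt y (hasStrictFDerivAt_norm_sq y).hasFDerivAt
      have h3 := Complex.ofRealCLM.hasFDerivAt.comp y h2
      refine h3.congr_fderiv ?_
      ext z
      simp
      ring
    set κ : ℂ := ((deriv shellBump (‖y‖ ^ 2) * 2 : ℝ) : ℂ) with hκ
    have hWi : ∀ i, fderiv ℝ (W i) y (b i) =
        κ * (G y * (inner ℝ y (b i) * fderiv ℝ F y (b i)) -
          F y * (inner ℝ y (b i) * fderiv ℝ G y (b i))) +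
        shellFun n y * (G y * fderiv ℝ (fderiv ℝ F) y (b i) (b i) -
          F y * fderiv ℝ (fderiv ℝ G) y (b i) (b i)) := by
      intro i
      have hF2 := hdF2.clm_apply (hasFDerivAt_const (b i) y)
      have hG2 := hdG2.clm_apply (hasFDerivAt_const (b i) y)
      have hWd : HasFDerivAt (W i) _ y := hχ.mul ((hdG.mul hF2).sub (hdF.mul hG2))
      rw [hWd.fderiv]
      simp
      ring
    have hsum : ∀ {H : (𝔼 n) → ℂ}, fderiv ℝ H y y = 0 →
        ∑ i, (inner ℝ y (b i) : ℂ) * fderiv ℝ H y (b i) = 0 := by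
      intro H hH
      have hyb : fderiv ℝ H y y = fderiv ℝ H y (∑ i, b.repr y i • b i) := by rw [b.sum_repr]
      rw [← hH, hyb, map_sum]
      refine Finset.sum_congr rfl fun i _ => ?_
      rw [map_smul, b.repr_apply_apply, real_inner_comm, Complex.real_smul]
    have hlapF : ∑ i, fderiv ℝ (fderiv ℝ F) y (b i) (b i) = Laplacian.laplacian F y := by
      rw [InnerProductSpace.laplacian_eq_iteratedFDeriv_orthonormalBasis _ b]
      simp [iteratedFDeriv_two_apply]
    have hlapG : ∑ i, fderiv ℝ (fderiv ℝ G) y (b i) (b i) = Laplacian.laplacian G y := by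
      rw [InnerProductSpace.laplacian_eq_iteratedFDeriv_orthonormalBasis _ b]
      simp [iteratedFDeriv_two_apply]
    simp only [hWi, Finset.sum_add_distrib, ← Finset.mul_sum, Finset.sum_sub_distrib]
    rw [hsum (fderiv_sphExt_self f.contMDiff hy), hsum (fderiv_sphExt_self g.contMDiff hy),
      hlapF, hlapG, laplacian_sphExt_eq f hy, laplacian_sphExt_eq g hy, shellFun]
    simp only [hF, hG, sphExt, hy, dite_false, u]
    ring
  have hint : ∫ y : 𝔼 n, sphExt u y *
      (((shellBump (‖y‖ ^ 2) : ℝ) : ℂ) * (((‖y‖ ^ 2)⁻¹ : ℝ) : ℂ)) = 0 := by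
    rw [← hdiv]
    refine integral_congr_ae ?_
    filter_upwards [compl_mem_ae_iff.2 (measure_singleton (0 : 𝔼 n))] with y hy
    exact (hpt y hy).symm
  rw [integral_sphExt_mul_norm u
    (fun r => ((shellBump (r ^ 2) : ℝ) : ℂ) * (((r ^ 2)⁻¹ : ℝ) : ℂ))] at hint
  have h0 := (mul_eq_zero.1 hint).resolve_right (radial_integral_ne_zero n)
  rw [← sub_eq_zero, ← integral_sub]
  · exact h0
  · exact integrable_sph ((sphLaplacian n f).contMDiff.continuous.mul g.contMDiff.continuous) _
  · exact integrable_sph (f.contMDiff.continuous.mul (sphLaplacian n g).contMDiff.continuous) _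

end Green

/-! ### Rotation invariance -/

section Rotation

variable {n : ℕ}

local notation "𝔼" n => EuclideanSpace ℝ (Fin (n + 1))

/-- The action of a linear isometry on the sphere. -/
def sphRot (R : (𝔼 n) ≃ₗᵢ[ℝ] (𝔼 n)) (x : Sph n) : Sph n :=
  ⟨R x, by simp⟩

theorem sphExt_comp_sphRot (R : (𝔼 n) ≃ₗᵢ[ℝ] (𝔼 n)) (h : Sph n → ℂ) :
    sphExt (h ∘ sphRot R) = sphExt h ∘ R := by
  funext x
  by_cases hx : x = 0
  · simp [sphExt, hx]
  · have hRx : R x ≠ 0 := by simpa using hx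
    simp only [sphExt, hx, hRx, dite_false, Function.comp]
    congr 1
    ext1
    simp [sphRot]

theorem integral_comp_sphRot (R : (𝔼 n) ≃ₗᵢ[ℝ] (𝔼 n)) (h : Sph n → ℂ) :
    ∫ x, h (sphRot R x) ∂(sphMeasure n) = ∫ x, h x ∂(sphMeasure n) := by
  let B : ℝ → ℂ := fun r => ((shellBump (r ^ 2) : ℝ) : ℂ) * (((r ^ 2)⁻¹ : ℝ) : ℂ)
  have h1 := integral_sphExt_mul_norm h B
  have h2 := integral_sphExt_mul_norm (h ∘ sphRot R) B
  have h3 : ∫ x : 𝔼 n, sphExt (h ∘ sphRot R) x * B ‖x‖ = ∫ x : 𝔼 n, sphExt h x * B ‖x‖ := by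
    rw [← R.measurePreserving.integral_comp R.toHomeomorph.measurableEmbedding
      fun x => sphExt h x * B ‖x‖]
    simp only [sphExt_comp_sphRot, Function.comp, R.norm_map]
  rw [h3, h1] at h2
  exact (mul_right_cancel₀ (radial_integral_ne_zero n) h2).symm

/-- Composition with a rotation, on the Schwartz space. -/
def Schwartz.rot (R : (𝔼 n) ≃ₗᵢ[ℝ] (𝔼 n)) (h : Schwartz n) : Schwartz n :=
  ⟨h ∘ sphRot R, by
    have := Fact.mk (@finrank_euclideanSpace_fin ℝ _ (n + 1))
    have h1 : ContMDiff (𝓡 n) 𝓘(ℝ, 𝔼 n) ∞ fun x : Sph n => R (x : 𝔼 n) :=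
      R.toContinuousLinearEquiv.contDiff.contMDiff.comp contMDiff_coe_sphere
    exact h.contMDiff.comp (h1.codRestrict_sphere fun x => (sphRot R x).2)⟩

theorem rot_apply (R : (𝔼 n) ≃ₗᵢ[ℝ] (𝔼 n)) (h : Schwartz n) (x : Sph n) :
    h.rot R x = h (sphRot R x) := rfl

theorem sphLaplacian_rot (R : (𝔼 n) ≃ₗᵢ[ℝ] (𝔼 n)) (h : Schwartz n) :
    sphLaplacian n (h.rot R) = (sphLaplacian n h).rot R := by
  ext x
  change Laplacian.laplacian (sphExt (h ∘ sphRot R)) x = Laplacian.laplacian (sphExt h) (R x)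
  rw [sphExt_comp_sphRot]
  set b := EuclideanSpace.basisFun (Fin (n + 1)) ℝ with hb
  have h1 : fderiv ℝ (sphExt h ∘ R) = fun y => (fderiv ℝ (sphExt h) (R y)).comp
      (R.toContinuousLinearEquiv : (𝔼 n) →L[ℝ] 𝔼 n) := by
    funext y
    exact R.toContinuousLinearEquiv.comp_right_fderiv
  have hx : R (x : 𝔼 n) ≠ 0 := by simpa using ne_zero_of_mem_unit_sphere x
  have hd : HasFDerivAt (fderiv ℝ (sphExt h)) (fderiv ℝ (fderiv ℝ (sphExt h)) (R x)) (R x) :=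
    (((contDiffAt_sphExt h.contMDiff hx).fderiv_right (m := 1) (by norm_cast)).differentiableAt
      (by simp)).hasFDerivAt
  have h2 : ∀ e, fderiv ℝ (fderiv ℝ (sphExt h ∘ R)) x e e =
      fderiv ℝ (fderiv ℝ (sphExt h)) (R x) (R e) (R e) := by
    intro e
    have h3 := hd.comp (x : 𝔼 n) R.toContinuousLinearEquiv.hasFDerivAt
    have h4 := h3.clm_comp (hasFDerivAt_const
      (R.toContinuousLinearEquiv : (𝔼 n) →L[ℝ] 𝔼 n) (x : 𝔼 n))
    rw [h1]
    erw [h4.fderiv]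
    simp
  rw [InnerProductSpace.laplacian_eq_iteratedFDeriv_orthonormalBasis _ b,
    InnerProductSpace.laplacian_eq_iteratedFDeriv_orthonormalBasis _ (b.map R)]
  simp only [iteratedFDeriv_two_apply]
  refine Finset.sum_congr rfl fun i _ => ?_
  simpa using h2 (b i)

theorem rot_mem_sphHarm (R : (𝔼 n) ≃ₗᵢ[ℝ] (𝔼 n)) {k : ℕ} {h : Schwartz n}
    (hh : h ∈ sphHarm n k) : h.rot R ∈ sphHarm n k := by
  rw [mem_sphHarm_iff] at hh ⊢
  rw [sphLaplacian_rot, hh]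
  rfl

/-- Isometries act transitively on the sphere: a reflection exchanges two given points. -/
theorem exists_sphRot_eq (x y : Sph n) : ∃ R : (𝔼 n) ≃ₗᵢ[ℝ] (𝔼 n), sphRot R x = y := by
  refine ⟨(ℝ ∙ ((x : 𝔼 n) - y))ᗮ.reflection, Subtype.ext ?_⟩
  exact Submodule.reflection_sub (by simp)

end Rotation

/-! ### Orthogonality and polynomiality of the spherical harmonics -/

section Orthogonality

variable {n : ℕ}

/-- A continuous function on the sphere as an element of `L²`. -/
abbrev contToL2 (n : ℕ) : C(Sph n, ℂ) →L[ℂ] Lp ℂ 2 (sphMeasure n) :=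
  ContinuousMap.toLp 2 (sphMeasure n) ℂ

/-- A smooth function on the sphere as an element of `L²`. -/
def Schwartz.toL2 (n : ℕ) : Schwartz n →ₗ[ℂ] Lp ℂ 2 (sphMeasure n) :=
  (contToL2 n).toLinearMap ∘ₗ Schwartz.toCont n

theorem inner_contToL2 (η θ : C(Sph n, ℂ)) :
    inner ℂ (contToL2 n θ) (contToL2 n η) = ∫ x, η x * conj (θ x) ∂(sphMeasure n) :=
  ContinuousMap.inner_toLp _ _ _

theorem sphInner_eq_inner (f g : Schwartz n) :
    sphInner f g = inner ℂ (Schwartz.toL2 n g) (Schwartz.toL2 n f) :=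
  (inner_contToL2 (Schwartz.toCont n f) (Schwartz.toCont n g)).symm

theorem contToL2_injective : Function.Injective (contToL2 n) :=
  ContinuousMap.toLp_injective _

theorem toCont_injective : Function.Injective (Schwartz.toCont n) := fun _ _ h =>
  Schwartz.ext fun x => DFunLike.congr_fun h x

theorem toL2_injective : Function.Injective (Schwartz.toL2 n) :=
  contToL2_injective.comp toCont_injective

theorem sphInner_add_left (f g h : Schwartz n) :
    sphInner (f + g) h = sphInner f h + sphInner g h := by
  simp only [sphInner_eq_inner, map_add, inner_add_right]

theorem sphInner_smul_left (c : ℂ) (f g : Schwartz n) : sphInner (c • f) g = c * sphInner f g := by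
  simp only [sphInner_eq_inner, map_smul, inner_smul_right]

theorem sphInner_smul_right (c : ℂ) (f g : Schwartz n) :
    sphInner f (c • g) = conj c * sphInner f g := by
  simp only [sphInner_eq_inner, map_smul, inner_smul_left]

theorem sphInner_sum_left {ι : Type*} (s : Finset ι) (f : ι → Schwartz n) (g : Schwartz n) :
    sphInner (∑ i ∈ s, f i) g = ∑ i ∈ s, sphInner (f i) g := by
  simp only [sphInner_eq_inner, map_sum, inner_sum]

theorem conj_sphInner (f g : Schwartz n) : conj (sphInner f g) = sphInner g f := by
  simp only [sphInner_eq_inner, inner_conj_symm]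

/-- Complex conjugation on the Schwartz space. -/
def Schwartz.conj (h : Schwartz n) : Schwartz n :=
  ⟨fun x => starRingEnd ℂ (h x), Complex.conjCLE.contDiff.contMDiff.comp h.contMDiff⟩

theorem sphLaplacian_conj (h : Schwartz n) : sphLaplacian n h.conj = (sphLaplacian n h).conj := by
  ext x
  have hx : (x : EuclideanSpace ℝ (Fin (n + 1))) ≠ 0 := ne_zero_of_mem_unit_sphere x
  have he : sphExt (h.conj : Sph n → ℂ) = (Complex.conjCLE : ℂ →L[ℝ] ℂ) ∘ sphExt h := by
    funext y
    by_cases hy : y = 0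
    · simp [sphExt, hy]
    · simp only [sphExt, hy, dite_false, Function.comp]
      rfl
  change Laplacian.laplacian (sphExt h.conj) x = _
  rw [he, ContDiffAt.laplacian_CLM_comp_left
    ((contDiffAt_sphExt h.contMDiff hx).of_le (by norm_cast))]
  rfl

theorem sphInner_sphLaplacian (f g : Schwartz n) :
    sphInner (sphLaplacian n f) g = sphInner f (sphLaplacian n g) := by
  have h := integral_sphLaplacian_mul f g.conj
  rw [sphLaplacian_conj] at h
  exact h

theorem sphInner_eq_zero (hn : 1 ≤ n) {j k : ℕ} (hjk : j ≠ k) {f g : Schwartz n}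
    (hf : f ∈ sphHarm n j) (hg : g ∈ sphHarm n k) : sphInner f g = 0 := by
  have h := sphInner_sphLaplacian f g
  rw [mem_sphHarm_iff.1 hf, mem_sphHarm_iff.1 hg, sphInner_smul_left, sphInner_smul_right, map_neg,
    Complex.conj_ofReal, ← sub_eq_zero, ← sub_mul] at h
  refine (mul_eq_zero.1 h).resolve_left ?_
  rw [sub_eq_zero, neg_inj]
  exact_mod_cast (sphEig_strictMono hn).injective.ne hjk

/-- A continuous function orthogonal to the polynomial spherical harmonics vanishes. -/
theorem eq_zero_of_orthogonal_sphHarm_inf_sphPoly (hn : 1 ≤ n) (η : C(Sph n, ℂ))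
    (h : ∀ k, ∀ Y ∈ sphHarm n k ⊓ sphPoly n k,
      inner ℂ (Schwartz.toL2 n Y) (contToL2 n η) = 0) : η = 0 := by
  let L : C(Sph n, ℂ) →L[ℂ] ℂ := innerSL ℂ (contToL2 n η) ∘L contToL2 n
  have hle : (⨆ k, (sphHarm n k ⊓ sphPoly n k).map (Schwartz.toCont n)).topologicalClosure ≤
      LinearMap.ker L.toLinearMap := by
    refine Submodule.topologicalClosure_minimal _ (iSup_le fun k => ?_) L.isClosed_ker
    rintro _ ⟨Y, hY, rfl⟩
    change inner ℂ (contToL2 n η) (Schwartz.toL2 n Y) = 0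
    rw [← inner_conj_symm, h k Y hY, map_zero]
  rw [topologicalClosure_sphHarm_inf_sphPoly hn] at hle
  have h0 : inner ℂ (contToL2 n η) (contToL2 n η) = 0 := hle (Submodule.mem_top (x := η))
  rw [inner_self_eq_zero] at h0
  exact contToL2_injective (by rw [h0, map_zero])

/-- Every spherical harmonic of order `k` is a polynomial of degree at most `k`: the component
orthogonal to the polynomial ones is orthogonal to a dense subspace. -/
theorem sphHarm_le_sphPoly (hn : 1 ≤ n) (k : ℕ) : sphHarm n k ≤ sphPoly n k := by
  intro h hh
  let K := (sphHarm n k ⊓ sphPoly n k).map (Schwartz.toL2 n)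
  have : FiniteDimensional ℂ (sphHarm n k ⊓ sphPoly n k : Submodule ℂ (Schwartz n)) :=
    Submodule.finiteDimensional_of_le inf_le_right
  have : FiniteDimensional ℂ K := inferInstance
  obtain ⟨q, hq, hqK⟩ := (K.starProjection_apply_mem (Schwartz.toL2 n h))
  have horth : ∀ Y ∈ sphHarm n k ⊓ sphPoly n k,
      inner ℂ (Schwartz.toL2 n Y) (Schwartz.toL2 n (h - q)) = 0 := by
    intro Y hY
    rw [map_sub, hqK]
    exact K.sub_starProjection_mem_orthogonal (Schwartz.toL2 n h) _ ⟨Y, hY, rfl⟩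
  have h0 : Schwartz.toCont n (h - q) = 0 := by
    refine eq_zero_of_orthogonal_sphHarm_inf_sphPoly hn _ fun j Y hY => ?_
    rcases eq_or_ne k j with rfl | hjk
    · exact horth Y hY
    · have := sphInner_eq_zero hn hjk (sub_mem hh hq.1) hY.1
      rwa [sphInner_eq_inner] at this
  have h1 : h - q = 0 := toCont_injective (by rw [h0, map_zero])
  rw [sub_eq_zero.1 h1]
  exact hq.2

theorem finiteDimensional_sphHarm (hn : 1 ≤ n) (k : ℕ) : FiniteDimensional ℂ (sphHarm n k) :=
  Submodule.finiteDimensional_of_le (sphHarm_le_sphPoly hn k)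

theorem finrank_sphHarm_le (hn : 1 ≤ n) (k : ℕ) :
    Module.finrank ℂ (sphHarm n k) ≤ (k + 1) ^ (n + 1) :=
  (Submodule.finrank_mono (sphHarm_le_sphPoly hn k)).trans (finrank_sphPoly_le k)

theorem exists_isHarmONB (hn : 1 ≤ n) (k : ℕ) :
    ∃ Y : Fin (Module.finrank ℂ (sphHarm n k)) → Schwartz n, IsHarmONB k Y := by
  have := finiteDimensional_sphHarm hn k
  let e := Submodule.equivMapOfInjective (Schwartz.toL2 n) toL2_injective (sphHarm n k)
  let b := (stdOrthonormalBasis ℂ ((sphHarm n k).map (Schwartz.toL2 n))).reindex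
    (finCongr e.finrank_eq.symm)
  have hb : ∀ i, Schwartz.toL2 n (e.symm (b i)) = b i := fun i => by
    rw [← Submodule.coe_equivMapOfInjective_apply (Schwartz.toL2 n) toL2_injective,
      LinearEquiv.apply_symm_apply]
  refine ⟨fun i => e.symm (b i), ⟨fun i j => ?_, ?_⟩⟩
  · rw [sphInner_eq_inner, hb, hb, ← Submodule.coe_inner, b.inner_eq_ite]
    simp only [eq_comm]
  · have h1 : Submodule.span ℂ (Set.range fun i => e.symm (b i)) = ⊤ := by
      have := b.toBasis.map e.symm |>.span_eq
      rw [Module.Basis.coe_map, OrthonormalBasis.coe_toBasis] at this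
      exact this
    have h2 := congrArg (Submodule.map (sphHarm n k).subtype) h1
    rw [Submodule.map_span, ← Set.range_comp, Submodule.map_subtype_top] at h2
    exact h2

end Orthogonality

/-! ### Bounds from the reproducing kernel -/

section Bounds

variable {n : ℕ} {k N : ℕ} {Y : Fin N → Schwartz n}

theorem IsHarmONB.mem (hY : IsHarmONB k Y) (m : Fin N) : Y m ∈ sphHarm n k :=
  hY.span_eq ▸ Submodule.subset_span ⟨m, rfl⟩

theorem IsHarmONB.sphInner_sum (hY : IsHarmONB k Y) (c : Fin N → ℂ) (m : Fin N) :
    sphInner (∑ i, c i • Y i) (Y m) = c m := by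
  rw [sphInner_sum_left]
  simp [sphInner_smul_left, hY.orthonormal]

theorem IsHarmONB.sum_repr (hY : IsHarmONB k Y) {h : Schwartz n} (hh : h ∈ sphHarm n k) :
    ∑ m, sphInner h (Y m) • Y m = h := by
  rw [← hY.span_eq, Submodule.mem_span_range_iff_exists_fun] at hh
  obtain ⟨c, rfl⟩ := hh
  simp only [hY.sphInner_sum]

theorem IsHarmONB.sphInner_self (hY : IsHarmONB k Y) (c : Fin N → ℂ) :
    sphInner (∑ i, c i • Y i) (∑ i, c i • Y i) = ((∑ i, ‖c i‖ ^ 2 : ℝ) : ℂ) := by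
  rw [sphInner_sum_left]
  push_cast
  refine Finset.sum_congr rfl fun i _ => ?_
  rw [sphInner_smul_left, ← conj_sphInner, hY.sphInner_sum, Complex.mul_conj']

theorem sphInner_rot (R : EuclideanSpace ℝ (Fin (n + 1)) ≃ₗᵢ[ℝ] EuclideanSpace ℝ (Fin (n + 1)))
    (f g : Schwartz n) : sphInner (f.rot R) (g.rot R) = sphInner f g :=
  integral_comp_sphRot R fun x => f x * conj (g x)

theorem measureReal_sph_pos (n : ℕ) : 0 < (sphMeasure n).real Set.univ := by
  rw [measureReal_def]
  refine ENNReal.toReal_pos ?_ (measure_ne_top _ _)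
  rw [Measure.measure_univ_ne_zero]
  exact Measure.toSphere_ne_zero _

/-- The diagonal `∑ |Y_m x|²` of the reproducing kernel is rotation invariant, hence constant, hence
equal to its mean. -/
theorem IsHarmONB.sum_norm_sq_le (hY : IsHarmONB k Y) (x : Sph n) :
    (∑ m, ‖Y m x‖ ^ 2) * (sphMeasure n).real Set.univ ≤ N := by
  set K : Sph n → ℝ := fun y => ∑ m, ‖Y m y‖ ^ 2 with hK
  have hK0 : ∀ y, 0 ≤ K y := fun y => Finset.sum_nonneg fun _ _ => sq_nonneg _
  have hle : ∀ y, K x ≤ K y := by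
    intro y
    obtain ⟨R, hR⟩ := exists_sphRot_eq y x
    -- the reproducing kernel at `x`, turned so that its pole is `y`
    set h : Schwartz n := ∑ m, conj (Y m x) • Y m with hh
    have hmem : h ∈ sphHarm n k := Submodule.sum_mem _ fun m _ => Submodule.smul_mem _ _ (hY.mem m)
    have hx : h x = (K x : ℂ) := by
      rw [hh, Schwartz.sum_apply, hK]
      push_cast
      exact Finset.sum_congr rfl fun m _ => by rw [Schwartz.smul_apply, Complex.conj_mul']
    set d : Fin N → ℂ := fun m => sphInner (h.rot R) (Y m) with hd
    have hrepr : ∑ m, d m • Y m = h.rot R := hY.sum_repr (rot_mem_sphHarm R hmem)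
    have hd2 : ∑ m, ‖d m‖ ^ 2 = K x := by
      have h1 := hY.sphInner_self d
      rw [hrepr, sphInner_rot, hh, hY.sphInner_self] at h1
      have h2 := Complex.ofReal_injective h1
      rw [← h2]
      simp [hK]
    have h3 : (K x : ℂ) = ∑ m, d m * Y m y := by
      rw [← hx, ← hR, ← rot_apply, ← hrepr, Schwartz.sum_apply]
      rfl
    have h4 : K x ≤ ∑ m, ‖d m‖ * ‖Y m y‖ := by
      calc K x = ‖(K x : ℂ)‖ := by rw [Complex.norm_real, Real.norm_of_nonneg (hK0 x)]
        _ ≤ ∑ m, ‖d m * Y m y‖ := by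
          rw [h3]
          exact norm_sum_le _ _
        _ = _ := by simp only [norm_mul]
    have h5 := Finset.sum_mul_sq_le_sq_mul_sq Finset.univ (fun m => ‖d m‖) fun m => ‖Y m y‖
    rw [hd2] at h5
    have h6 : K x * K x ≤ K x * K y := by
      refine le_trans ?_ h5
      rw [← sq]
      exact pow_le_pow_left₀ (hK0 x) h4 2
    rcases (hK0 x).eq_or_lt with h0 | h0
    · rw [← h0]
      exact hK0 y
    · exact le_of_mul_le_mul_left h6 h0
  have hKc : Continuous K := continuous_finsetSum _ fun m _ =>
    ((Y m).contMDiff.continuous.norm.pow 2)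
  have hint : ∫ y, K y ∂(sphMeasure n) = N := by
    have h1 : ∀ m, ∫ y, ‖Y m y‖ ^ 2 ∂(sphMeasure n) = 1 := by
      intro m
      have := hY.orthonormal m m
      rw [if_pos rfl, sphInner] at this
      simp only [Complex.mul_conj'] at this
      have h2 : ∫ y, ((‖Y m y‖ ^ 2 : ℝ) : ℂ) ∂(sphMeasure n) = 1 := by
        simpa using this
      rw [integral_complex_ofReal] at h2
      exact_mod_cast h2
    rw [hK, integral_finsetSum]
    · simp [h1]
    · intro m _
      exact ((Y m).contMDiff.continuous.norm.pow 2).integrable_of_hasCompactSupport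
        (HasCompactSupport.of_compactSpace _)
  rw [← hint]
  calc K x * (sphMeasure n).real Set.univ = ∫ _, K x ∂(sphMeasure n) := by
        rw [integral_const, smul_eq_mul, mul_comm]
    _ ≤ _ := integral_mono (integrable_const _)
      (hKc.integrable_of_hasCompactSupport (HasCompactSupport.of_compactSpace _)) hle

/-- The orthogonal projection onto the spherical harmonics of order `k` is bounded for the supremum
norm, with a bound which is polynomial in `k`. -/
theorem IsHarmONB.norm_sum_le (hY : IsHarmONB k Y) (h : Schwartz n) :
    ‖Schwartz.toCont n (∑ m, sphInner h (Y m) • Y m)‖ ≤ N ^ 2 * ‖Schwartz.toCont n h‖ := by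
  set S := (sphMeasure n).real Set.univ with hS
  have hS0 : 0 < S := measureReal_sph_pos n
  set M := √(N / S) with hM
  have hsup : ∀ m x, ‖Y m x‖ ≤ M := by
    intro m x
    refine Real.le_sqrt_of_sq_le ?_
    rw [le_div_iff₀ hS0]
    refine le_trans ?_ (hY.sum_norm_sq_le x)
    gcongr
    exact Finset.single_le_sum (f := fun m => ‖Y m x‖ ^ 2) (fun _ _ => sq_nonneg _)
      (Finset.mem_univ m)
  have hin : ∀ m, ‖sphInner h (Y m)‖ ≤ ‖Schwartz.toCont n h‖ * M * S := by
    intro m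
    refine norm_integral_le_of_norm_le_const (ae_of_all _ fun x => ?_)
    rw [norm_mul, RCLike.norm_conj]
    exact mul_le_mul ((Schwartz.toCont n h).norm_coe_le_norm x) (hsup m x) (norm_nonneg _)
      (norm_nonneg _)
  have hM2 : M * S * M = N := by
    rw [mul_right_comm, hM, Real.mul_self_sqrt (by positivity), div_mul_cancel₀ _ hS0.ne']
  refine (ContinuousMap.norm_le _ (by positivity)).2 fun x => ?_
  change ‖(∑ m, sphInner h (Y m) • Y m : Schwartz n) x‖ ≤ _
  rw [Schwartz.sum_apply]
  refine (_root_.norm_sum_le _ _).trans ?_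
  calc ∑ m, ‖(sphInner h (Y m) • Y m : Schwartz n) x‖
      ≤ ∑ _m : Fin N, ‖Schwartz.toCont n h‖ * M * S * M := by
        refine Finset.sum_le_sum fun m _ => ?_
        rw [Schwartz.smul_apply, norm_mul]
        exact mul_le_mul (hin m) (hsup m x) (norm_nonneg _) (by positivity)
    _ = N ^ 2 * ‖Schwartz.toCont n h‖ := by
        rw [Finset.sum_const, Finset.card_univ, Fintype.card_fin, nsmul_eq_mul, mul_assoc,
          mul_assoc, ← mul_assoc M, hM2]
        ring

end Bounds

/-! ### Projections onto the spherical harmonics -/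

section Projections

variable {n : ℕ} (hn : 1 ≤ n)

/-- A fixed orthonormal basis of the spherical harmonics of order `k`. -/
def harmBasis (k : ℕ) : Fin (Module.finrank ℂ (sphHarm n k)) → Schwartz n :=
  (exists_isHarmONB hn k).choose

theorem harmBasis_spec (k : ℕ) : IsHarmONB k (harmBasis hn k) := (exists_isHarmONB hn k).choose_spec

/-- The orthogonal projection onto the spherical harmonics of order `k`. -/
def harmProj (k : ℕ) : Schwartz n →ₗ[ℂ] Schwartz n where
  toFun h := ∑ m, sphInner h (harmBasis hn k m) • harmBasis hn k m
  map_add' f g := by simp only [sphInner_add_left, add_smul, Finset.sum_add_distrib]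
  map_smul' c f := by simp only [sphInner_smul_left, mul_smul, Finset.smul_sum, RingHom.id_apply]

theorem harmProj_apply (k : ℕ) (h : Schwartz n) :
    harmProj hn k h = ∑ m, sphInner h (harmBasis hn k m) • harmBasis hn k m := rfl

theorem harmProj_mem (k : ℕ) (h : Schwartz n) : harmProj hn k h ∈ sphHarm n k :=
  Submodule.sum_mem _ fun m _ => Submodule.smul_mem _ _ ((harmBasis_spec hn k).mem m)

theorem harmProj_congr {k : ℕ} {f g : Schwartz n}
    (h : ∀ Z ∈ sphHarm n k, sphInner f Z = sphInner g Z) : harmProj hn k f = harmProj hn k g := by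
  rw [harmProj_apply, harmProj_apply]
  exact Finset.sum_congr rfl fun m _ => by rw [h _ ((harmBasis_spec hn k).mem m)]

theorem sphInner_harmProj {k : ℕ} (h : Schwartz n) {Z : Schwartz n} (hZ : Z ∈ sphHarm n k) :
    sphInner (harmProj hn k h) Z = sphInner h Z := by
  rw [← (harmBasis_spec hn k).span_eq] at hZ
  induction hZ using Submodule.span_induction with
  | mem x hx =>
    obtain ⟨m, rfl⟩ := hx
    exact (harmBasis_spec hn k).sphInner_sum _ m
  | zero => simp only [sphInner_eq_inner, map_zero, inner_zero_left]
  | add x y _ _ hx hy =>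
    rw [← conj_sphInner, sphInner_add_left, map_add, conj_sphInner, conj_sphInner, hx, hy,
      ← conj_sphInner _ h, ← conj_sphInner _ h, ← map_add, ← sphInner_add_left, conj_sphInner]
  | smul c x _ hx => rw [sphInner_smul_right, sphInner_smul_right, hx]

theorem pow_apply_sphHarm {k : ℕ} {h : Schwartz n} (hh : h ∈ sphHarm n k) (j : ℕ) :
    ((LinearMap.id - sphLaplacian n) ^ j : Schwartz n →ₗ[ℂ] Schwartz n) h =
      ((1 + sphEig n k : ℝ) : ℂ) ^ j • h := by
  induction j with
  | zero => simp
  | succ j ih =>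
    rw [pow_succ', Module.End.mul_apply, ih, map_smul, LinearMap.sub_apply, LinearMap.id_apply,
      mem_sphHarm_iff.1 hh, pow_succ, mul_smul, neg_smul, sub_neg_eq_add]
    push_cast
    rw [add_smul, one_smul]

/-- The powers of `Id - Δ` are symmetric. -/
theorem sphInner_pow_left (j : ℕ) (f g : Schwartz n) :
    sphInner (((LinearMap.id - sphLaplacian n) ^ j : Schwartz n →ₗ[ℂ] Schwartz n) f) g =
      sphInner f (((LinearMap.id - sphLaplacian n) ^ j : Schwartz n →ₗ[ℂ] Schwartz n) g) := by
  have hsub : ∀ a b c : Schwartz n, sphInner (a - b) c = sphInner a c - sphInner b c := by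
    intro a b c
    simp only [sphInner_eq_inner, map_sub, inner_sub_right]
  have hsub' : ∀ a b c : Schwartz n, sphInner a (b - c) = sphInner a b - sphInner a c := by
    intro a b c
    simp only [sphInner_eq_inner, map_sub, inner_sub_left]
  induction j generalizing g with
  | zero => simp
  | succ j ih =>
    rw [pow_succ', Module.End.mul_apply, LinearMap.sub_apply, LinearMap.id_apply, hsub,
      sphInner_sphLaplacian, ← hsub', ih, ← pow_succ', pow_succ]
    rfl

theorem harmProj_pow (k j : ℕ) (h : Schwartz n) :
    harmProj hn k (((LinearMap.id - sphLaplacian n) ^ j : Schwartz n →ₗ[ℂ] Schwartz n) h) =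
      ((1 + sphEig n k : ℝ) : ℂ) ^ j • harmProj hn k h := by
  rw [← map_smul]
  refine harmProj_congr hn fun Z hZ => ?_
  rw [sphInner_pow_left, pow_apply_sphHarm hZ, sphInner_smul_left, sphInner_smul_right, map_pow,
    Complex.conj_ofReal]

theorem norm_harmProj_le (k : ℕ) (h : Schwartz n) :
    ‖Schwartz.toCont n (harmProj hn k h)‖ ≤
      ((k : ℝ) + 1) ^ (2 * (n + 1)) * ‖Schwartz.toCont n h‖ := by
  refine ((harmBasis_spec hn k).norm_sum_le h).trans ?_
  have : (Module.finrank ℂ (sphHarm n k) : ℝ) ≤ ((k : ℝ) + 1) ^ (n + 1) := by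
    exact_mod_cast finrank_sphHarm_le hn k
  rw [mul_comm 2, pow_mul]
  gcongr

theorem sq_le_two_mul_sphEig {n : ℕ} (hn : 1 ≤ n) (k : ℕ) :
    ((k : ℝ) + 1) ^ 2 ≤ 2 * (1 + sphEig n k) := by
  have h1 : (1 : ℝ) ≤ n := by exact_mod_cast hn
  have hk : (0 : ℝ) ≤ k := k.cast_nonneg
  rw [sphEig]
  nlinarith [sq_nonneg ((k : ℝ) - 1), mul_nonneg hk (sub_nonneg.2 h1)]

/-- The projections of a smooth function decrease faster than any power of the order, since
`(1 + λ_k) ^ j P_k h = P_k ((Id - Δ) ^ j h)`. -/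
theorem norm_harmProj_decay (q k : ℕ) (h : Schwartz n) :
    ((k : ℝ) + 1) ^ q * ‖Schwartz.toCont n (harmProj hn k h)‖ ≤
      2 ^ (n + 2 + q) * sphSeminorms n (n + 2 + q) h * (((k : ℝ) + 1) ^ 2)⁻¹ := by
  set j := n + 2 + q with hj
  set a := ‖Schwartz.toCont n (harmProj hn k h)‖ with ha
  have hk : (0 : ℝ) < (k : ℝ) + 1 := by positivity
  have hE := sq_le_two_mul_sphEig hn k
  have hE0 : 0 < 1 + sphEig n k := by nlinarith
  have h1 := norm_harmProj_le hn k
    (((LinearMap.id - sphLaplacian n) ^ j : Schwartz n →ₗ[ℂ] Schwartz n) h)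
  rw [harmProj_pow, map_smul, norm_smul, norm_pow, Complex.norm_real,
    Real.norm_of_nonneg hE0.le] at h1
  change (1 + sphEig n k) ^ j * a ≤ _ * sphSeminorms n j h at h1
  have h2 : (((k : ℝ) + 1) ^ 2) ^ j * a ≤
      ((k : ℝ) + 1) ^ (2 * (n + 1)) * (2 ^ j * sphSeminorms n j h) := by
    calc (((k : ℝ) + 1) ^ 2) ^ j * a ≤ (2 * (1 + sphEig n k)) ^ j * a := by gcongr
      _ = 2 ^ j * ((1 + sphEig n k) ^ j * a) := by rw [mul_pow, mul_assoc]
      _ ≤ 2 ^ j * (((k : ℝ) + 1) ^ (2 * (n + 1)) * sphSeminorms n j h) := by gcongr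
      _ = _ := by ring
  have h3 : (((k : ℝ) + 1) ^ 2) ^ j =
      ((k : ℝ) + 1) ^ (2 * (n + 1)) * (((k : ℝ) + 1) ^ 2 * (((k : ℝ) + 1) ^ q *
        ((k : ℝ) + 1) ^ q)) := by
    rw [hj]
    generalize (k : ℝ) + 1 = x
    ring
  rw [h3, mul_assoc] at h2
  have h4 := le_of_mul_le_mul_left h2 (by positivity)
  rw [le_mul_inv_iff₀ (by positivity)]
  refine le_trans ?_ h4
  have h5 : (1 : ℝ) ≤ ((k : ℝ) + 1) ^ q := one_le_pow₀ (by linarith [k.cast_nonneg (α := ℝ)])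
  have h6 : 0 ≤ ((k : ℝ) + 1) ^ 2 * ((k : ℝ) + 1) ^ q * a := by positivity
  calc ((k : ℝ) + 1) ^ q * a * ((k : ℝ) + 1) ^ 2
      = 1 * (((k : ℝ) + 1) ^ 2 * ((k : ℝ) + 1) ^ q * a) := by ring
    _ ≤ ((k : ℝ) + 1) ^ q * (((k : ℝ) + 1) ^ 2 * ((k : ℝ) + 1) ^ q * a) := by gcongr
    _ = _ := by ring

theorem summable_inv_sq : Summable fun k : ℕ => (((k : ℝ) + 1) ^ 2)⁻¹ := by
  have := (summable_nat_add_iff 1).2 (Real.summable_nat_pow_inv.2 one_lt_two)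
  simpa using this

/-- A continuous function orthogonal to all spherical harmonics vanishes. -/
theorem eq_zero_of_orthogonal {n : ℕ} (hn : 1 ≤ n) (η : C(Sph n, ℂ))
    (h : ∀ k, ∀ Y ∈ sphHarm n k, inner ℂ (Schwartz.toL2 n Y) (contToL2 n η) = 0) : η = 0 :=
  eq_zero_of_orthogonal_sphHarm_inf_sphPoly hn η fun k Y hY => h k Y hY.1

end Projections

/-! ### Fourier multipliers and completeness -/

section Multipliers

variable {n : ℕ} (hn : 1 ≤ n) {c : ℕ → ℂ} {C : ℝ} {q : ℕ}

theorem norm_multiplier_term_le (hc : ∀ k, ‖c k‖ ≤ C * ((k : ℝ) + 1) ^ q) (h : Schwartz n) (k : ℕ) :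
    ‖c k • Schwartz.toCont n (harmProj hn k h)‖ ≤
      C * (2 ^ (n + 2 + q) * sphSeminorms n (n + 2 + q) h) * (((k : ℝ) + 1) ^ 2)⁻¹ := by
  have hC : 0 ≤ C := by simpa using (norm_nonneg _).trans (hc 0)
  rw [norm_smul]
  calc ‖c k‖ * ‖Schwartz.toCont n (harmProj hn k h)‖
      ≤ C * ((k : ℝ) + 1) ^ q * ‖Schwartz.toCont n (harmProj hn k h)‖ := by
        gcongr
        exact hc k
    _ = C * (((k : ℝ) + 1) ^ q * ‖Schwartz.toCont n (harmProj hn k h)‖) := by ring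
    _ ≤ C * (2 ^ (n + 2 + q) * sphSeminorms n (n + 2 + q) h * (((k : ℝ) + 1) ^ 2)⁻¹) :=
        mul_le_mul_of_nonneg_left (norm_harmProj_decay hn q k h) hC
    _ = _ := by ring

theorem summable_multiplier (hc : ∀ k, ‖c k‖ ≤ C * ((k : ℝ) + 1) ^ q) (h : Schwartz n) :
    Summable fun k => c k • Schwartz.toCont n (harmProj hn k h) :=
  Summable.of_norm_bounded (summable_inv_sq.mul_left _) (norm_multiplier_term_le hn hc h)

/-- The Fourier multiplier `h ↦ ∑ c_k P_k h`, with uniform convergence, for `c` of polynomial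
growth. -/
def multiplier (hc : ∀ k, ‖c k‖ ≤ C * ((k : ℝ) + 1) ^ q) : Schwartz n →ₗ[ℂ] C(Sph n, ℂ) where
  toFun h := ∑' k, c k • Schwartz.toCont n (harmProj hn k h)
  map_add' f g := by
    rw [← (summable_multiplier hn hc f).tsum_add (summable_multiplier hn hc g)]
    exact tsum_congr fun k => by
      rw [map_add, map_add]
      exact ContinuousMap.ext fun x => mul_add _ _ _
  map_smul' b f := by
    simp only [map_smul, RingHom.id_apply, smul_comm _ b]
    exact (summable_multiplier hn hc f).tsum_const_smul b

theorem hasSum_multiplier (hc : ∀ k, ‖c k‖ ≤ C * ((k : ℝ) + 1) ^ q) (h : Schwartz n) :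
    HasSum (fun k => c k • Schwartz.toCont n (harmProj hn k h)) (multiplier hn hc h) :=
  (summable_multiplier hn hc h).hasSum

/-- A multiplier of polynomial growth is continuous on the Schwartz space. -/
theorem exists_norm_multiplier_le (hc : ∀ k, ‖c k‖ ≤ C * ((k : ℝ) + 1) ^ q) :
    ∃ (J : ℕ) (M : ℝ), 0 ≤ M ∧ ∀ h, ‖multiplier hn hc h‖ ≤ M * sphSeminorms n J h := by
  have hC : 0 ≤ C := by simpa using (norm_nonneg _).trans (hc 0)
  have hs : 0 ≤ ∑' k : ℕ, (((k : ℝ) + 1) ^ 2)⁻¹ := tsum_nonneg fun k => by positivity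
  refine ⟨n + 2 + q, C * 2 ^ (n + 2 + q) * ∑' k : ℕ, (((k : ℝ) + 1) ^ 2)⁻¹, by positivity,
    fun h => ?_⟩
  refine (tsum_of_norm_bounded (summable_inv_sq.mul_left _).hasSum
    (norm_multiplier_term_le hn hc h)).trans_eq ?_
  rw [tsum_mul_left]
  ring

/-- The Fourier coefficients of the image under a multiplier. -/
theorem sphInner_multiplier (hc : ∀ k, ‖c k‖ ≤ C * ((k : ℝ) + 1) ^ q) (h : Schwartz n) {j : ℕ}
    {Z : Schwartz n} (hZ : Z ∈ sphHarm n j) :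
    inner ℂ (Schwartz.toL2 n Z) (contToL2 n (multiplier hn hc h)) = c j * sphInner h Z := by
  have h1 := (hasSum_multiplier hn hc h).mapL (innerSL ℂ (Schwartz.toL2 n Z) ∘L contToL2 n)
  have h2 : ∀ k, k ≠ j → (innerSL ℂ (Schwartz.toL2 n Z) ∘L contToL2 n)
      (c k • Schwartz.toCont n (harmProj hn k h)) = 0 := by
    intro k hk
    rw [map_smul, smul_eq_mul]
    have := sphInner_eq_zero hn hk (harmProj_mem hn k h) hZ
    rw [sphInner_eq_inner] at this
    exact mul_eq_zero_of_right _ this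
  have h3 := h1.unique (hasSum_single j h2)
  refine h3.trans ?_
  rw [map_smul, smul_eq_mul]
  congr 1
  exact (sphInner_eq_inner _ _).symm.trans (sphInner_harmProj hn h hZ)

/-- A smooth function whose Fourier coefficients are those of a multiplier is its image. -/
theorem multiplier_eq (hc : ∀ k, ‖c k‖ ≤ C * ((k : ℝ) + 1) ^ q) {h g : Schwartz n}
    (hg : ∀ k, ∀ Z ∈ sphHarm n k, sphInner g Z = c k * sphInner h Z) :
    multiplier hn hc h = Schwartz.toCont n g := by
  rw [← sub_eq_zero]
  refine eq_zero_of_orthogonal hn _ fun k Z hZ => ?_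
  rw [map_sub, inner_sub_right, sphInner_multiplier hn hc h hZ, ← hg k Z hZ, sphInner_eq_inner]
  exact sub_self _

/-- The expansion in spherical harmonics of a smooth function converges uniformly. -/
theorem hasSum_toCont_harmProj (h : Schwartz n) :
    HasSum (fun k => Schwartz.toCont n (harmProj hn k h)) (Schwartz.toCont n h) := by
  have hc : ∀ k, ‖(fun _ : ℕ => (1 : ℂ)) k‖ ≤ 1 * ((k : ℝ) + 1) ^ 0 := by simp
  have := hasSum_multiplier hn hc h
  rw [multiplier_eq hn hc (g := h) (by simp)] at this
  simpa using this

/-- The expansion in spherical harmonics of a smooth function converges in the Schwartz space. -/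
theorem hasSum_harmProj (h : Schwartz n) : HasSum (fun k => harmProj hn k h) h := by
  refine ((withSeminorms_schwartz n).tendsto_nhds _ h).2 fun j ε hε => ?_
  set A : Schwartz n →ₗ[ℂ] Schwartz n := (LinearMap.id - sphLaplacian n) ^ j with hA
  have h1 := hasSum_toCont_harmProj hn (A h)
  have h2 := (tendsto_iff_norm_sub_tendsto_zero.1 h1).eventually (gt_mem_nhds hε)
  refine h2.mono fun s hs => lt_of_eq_of_lt ?_ hs
  change ‖Schwartz.toCont n (A (∑ k ∈ s, harmProj hn k h - h))‖ = _
  rw [map_sub, map_sum, map_sub, map_sum]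
  congr 2
  refine Finset.sum_congr rfl fun k _ => ?_
  change _ = Schwartz.toCont n (harmProj hn k (A h))
  rw [hA, harmProj_pow, pow_apply_sphHarm (harmProj_mem hn k h)]

/-- A distribution which vanishes on the spherical harmonics vanishes. -/
theorem sphDist_eq_zero {n : ℕ} (hn : 1 ≤ n) (f : SphDist n)
    (h : ∀ k, ∀ Y ∈ sphHarm n k, f Y = 0) : f = 0 := by
  ext φ
  have h1 := (hasSum_harmProj hn φ).mapL f
  simp only [fun k => h k _ (harmProj_mem hn k φ)] at h1
  exact h1.unique hasSum_zero

/-- The smooth functions are dense in `C(𝕊, ℂ)`. -/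
theorem denseRange_toCont {n : ℕ} (hn : 1 ≤ n) : DenseRange (Schwartz.toCont n) := by
  have h1 := topologicalClosure_sphHarm_inf_sphPoly hn
  have h2 : (⨆ k, (sphHarm n k ⊓ sphPoly n k).map (Schwartz.toCont n)) ≤
      LinearMap.range (Schwartz.toCont n) := iSup_le fun k => LinearMap.map_le_range
  intro η
  have h3 : η ∈ (⨆ k, (sphHarm n k ⊓ sphPoly n k).map (Schwartz.toCont n)).topologicalClosure := by
    rw [h1]
    trivial
  exact closure_mono h2 h3

end Multipliers

/-! ### Total variation by smooth functions -/

section MeasureDual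

variable {n : ℕ}

/-- Integration against a complex measure, as an element of the dual of `C(𝕊, ℂ)`. -/
def measCLM (μ : ComplexMeasure (Sph n)) : C(Sph n, ℂ) →L[ℂ] ℂ :=
  LinearMap.mkContinuous
    { toFun := measPair μ
      map_add' := measPair_add_right μ
      map_smul' := measPair_smul_right μ } (tvNorm μ) (norm_measPair_le μ)

@[simp] theorem measCLM_apply (μ : ComplexMeasure (Sph n)) (η : C(Sph n, ℂ)) :
    measCLM μ η = measPair μ η := rfl

theorem tvNorm_nonneg (μ : ComplexMeasure (Sph n)) : 0 ≤ tvNorm μ := ENNReal.toReal_nonneg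

theorem tvNorm_le_of_forall (μ : ComplexMeasure (Sph n)) {b : ℝ} (hb : 0 ≤ b)
    (h : ∀ η, ‖measPair μ η‖ ≤ b * ‖η‖) : tvNorm μ ≤ b := by
  by_contra! hlt
  obtain ⟨η, hη, hη'⟩ := exists_lt_norm_measPair μ hlt
  nlinarith [h η]

theorem norm_measCLM (μ : ComplexMeasure (Sph n)) : ‖measCLM μ‖ = tvNorm μ :=
  le_antisymm (LinearMap.mkContinuous_norm_le _ (tvNorm_nonneg μ) _)
    (tvNorm_le_of_forall μ (norm_nonneg (measCLM μ)) (measCLM μ).le_opNorm)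

theorem eq_zero_of_tvNorm_eq_zero {μ : ComplexMeasure (Sph n)} (h : tvNorm μ = 0) : μ = 0 := by
  rw [tvNorm, ENNReal.toReal_eq_zero_iff, or_iff_left (measure_ne_top _ _)] at h
  exact VectorMeasure.variation_eq_zero.1 (Measure.measure_univ_eq_zero.1 h)

/-- A complex measure is determined by the integrals of smooth functions. -/
theorem measFun_injective (hn : 1 ≤ n) : Function.Injective (measFun n) := by
  refine (injective_iff_map_eq_zero _).2 fun μ hμ => eq_zero_of_tvNorm_eq_zero ?_
  have h : ⇑(measCLM μ) = fun _ => 0 :=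
    (denseRange_toCont hn).equalizer (measCLM μ).continuous continuous_const
      (funext fun φ => LinearMap.congr_fun hμ φ)
  refine le_antisymm (tvNorm_le_of_forall μ le_rfl fun η => ?_) (tvNorm_nonneg μ)
  rw [← measCLM_apply, h]
  simp

/-- The total variation is the supremum over smooth functions of supremum norm one. -/
theorem isLUB_tvNorm (hn : 1 ≤ n) (μ : ComplexMeasure (Sph n)) :
    IsLUB {r : ℝ | ∃ φ : Schwartz n, ‖Schwartz.toCont n φ‖ = 1 ∧
      r = ‖measPair μ (Schwartz.toCont n φ)‖} (tvNorm μ) := by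
  constructor
  · rintro _ ⟨φ, hφ, rfl⟩
    simpa [hφ] using norm_measPair_le μ (Schwartz.toCont n φ)
  · intro b hb
    have hscale : ∀ φ : Schwartz n, Schwartz.toCont n φ ≠ 0 →
        ‖measPair μ (Schwartz.toCont n φ)‖ ≤ b * ‖Schwartz.toCont n φ‖ := by
      intro φ hφ
      have hpos : 0 < ‖Schwartz.toCont n φ‖ := norm_pos_iff.2 hφ
      have h1 : ‖(((‖Schwartz.toCont n φ‖⁻¹ : ℝ)) : ℂ)‖ = ‖Schwartz.toCont n φ‖⁻¹ := by
        rw [Complex.norm_real, norm_inv, norm_norm]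
      have h2 := hb ⟨(((‖Schwartz.toCont n φ‖⁻¹ : ℝ)) : ℂ) • φ, by
        rw [map_smul, norm_smul, h1, inv_mul_cancel₀ hpos.ne'], rfl⟩
      rw [map_smul, measPair_smul_right, norm_mul, h1, inv_mul_le_iff₀ hpos] at h2
      rwa [mul_comm]
    have hb0 : 0 ≤ b := by
      have hne : Schwartz.toCont n (linPow 0 0) ≠ 0 := by
        intro h
        obtain ⟨x, hx⟩ :=
          (NormedSpace.sphere_nonempty (E := EuclideanSpace ℝ (Fin (n + 1))) (x := 0)).2 zero_le_one
        have := DFunLike.congr_fun h ⟨x, hx⟩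
        change (linPow 0 0 : Schwartz n) ⟨x, hx⟩ = 0 at this
        simp [linPow_apply] at this
      have h1 := (norm_nonneg _).trans (hscale _ hne)
      exact nonneg_of_mul_nonneg_left h1 (norm_pos_iff.2 hne)
    refine tvNorm_le_of_forall μ hb0 fun η => ?_
    refine (denseRange_toCont hn).induction_on (p := fun η => ‖measCLM μ η‖ ≤ b * ‖η‖) η
      (isClosed_le (by fun_prop) (by fun_prop)) fun φ => ?_
    by_cases hφ : Schwartz.toCont n φ = 0
    · rw [hφ, map_zero, norm_zero, norm_zero, mul_zero]
    · exact hscale φ hφ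

end MeasureDual

/-! ### Fourier coefficients -/

section Coefficients

variable {n : ℕ}

theorem conj_mem_sphHarm {k : ℕ} {Y : Schwartz n} (hY : Y ∈ sphHarm n k) :
    Y.conj ∈ sphHarm n k := by
  rw [mem_sphHarm_iff] at hY ⊢
  rw [sphLaplacian_conj, hY]
  ext x
  change conj (-(sphEig n k : ℂ) * Y x) = -(sphEig n k : ℂ) * conj (Y x)
  rw [map_mul, map_neg, Complex.conj_ofReal]

theorem Schwartz.conj_conj (Y : Schwartz n) : Y.conj.conj = Y :=
  Schwartz.ext fun x => Complex.conj_conj (Y x)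

theorem inner_toL2_conj (η : C(Sph n, ℂ)) (Y : Schwartz n) :
    inner ℂ (Schwartz.toL2 n Y.conj) (contToL2 n η) = contDist n η Y :=
  (inner_contToL2 η (Schwartz.toCont n Y.conj)).trans <|
    integral_congr_ae (ae_of_all _ fun x => congrArg (η x * ·) (Complex.conj_conj (Y x)))

theorem norm_toL2_sq (F : Schwartz n) :
    ‖Schwartz.toL2 n F‖ ^ 2 = ∫ x, ‖F x‖ ^ 2 ∂(sphMeasure n) := by
  have h1 : ((‖Schwartz.toL2 n F‖ ^ 2 : ℝ) : ℂ) = ((∫ x, ‖F x‖ ^ 2 ∂(sphMeasure n) : ℝ) : ℂ) := by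
    rw [Complex.ofReal_pow]
    refine Eq.trans ?_ (integral_ofReal (𝕜 := ℂ) (f := fun x => ‖F x‖ ^ 2))
    refine (inner_self_eq_norm_sq_to_K (𝕜 := ℂ) (Schwartz.toL2 n F)).symm.trans ?_
    rw [← sphInner_eq_inner]
    refine integral_congr_ae (ae_of_all _ fun x => ?_)
    simp [Complex.mul_conj']
  exact_mod_cast h1

/-- A smooth function is determined by its Fourier coefficients. -/
theorem eq_of_sphInner_eq (hn : 1 ≤ n) {f g : Schwartz n}
    (h : ∀ k, ∀ Z ∈ sphHarm n k, sphInner f Z = sphInner g Z) : f = g := by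
  refine toCont_injective ((hasSum_toCont_harmProj hn f).unique ?_)
  simpa only [fun k => harmProj_congr hn (h k)] using hasSum_toCont_harmProj hn g

theorem contDist_injective (hn : 1 ≤ n) : Function.Injective (contDist n) :=
  (injective_iff_map_eq_zero _).2 fun η hη => eq_zero_of_orthogonal hn η fun k Y hY => by
    rw [← Schwartz.conj_conj Y, inner_toL2_conj, hη]
    rfl

theorem continuous_of_seminorm_bound (L : Schwartz n →ₗ[ℂ] ℂ) (M : ℝ) (J : ℕ)
    (hL : ∀ φ, ‖L φ‖ ≤ M * sphSeminorms n J φ) : Continuous L := by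
  have hp : Continuous (sphSeminorms n J) := (withSeminorms_schwartz n).continuous_seminorm J
  refine continuous_of_continuousAt_zero L ?_
  rw [ContinuousAt, map_zero, tendsto_zero_iff_norm_tendsto_zero]
  refine squeeze_zero (fun _ => norm_nonneg _) hL ?_
  have : Tendsto (fun φ => M * sphSeminorms n J φ) (𝓝 (0 : Schwartz n))
      (𝓝 (M * sphSeminorms n J 0)) := ((continuous_const (y := M)).mul hp).tendsto 0
  rwa [map_zero, mul_zero] at this

end Coefficients

/-! ### The action of the operator and its left inverse -/

namespace IsPseudoDiffOp

variable {n : ℕ} {D : Schwartz n →ₗ[ℂ] Schwartz n} {a : ℕ → ℝ} {p : ℝ}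

/-- `D` multiplies the Fourier coefficients by its symbol: the coefficients of the partial sums of
`D h` are eventually constant, and they converge since the partial sums do so in `L²`. -/
theorem sphInner_apply (hn : 1 ≤ n) (hD : IsPseudoDiffOp D a p) (h : Schwartz n) {k : ℕ}
    {Z : Schwartz n} (hZ : Z ∈ sphHarm n k) : sphInner (D h) Z = a k * sphInner h Z := by
  let F : ℕ → Schwartz n := fun K => D h - ∑ j ∈ Finset.range K, (a j : ℂ) • harmProj hn j h
  have h1 : Tendsto (fun K => ‖Schwartz.toL2 n (F K)‖ ^ 2) atTop (𝓝 0) := by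
    refine (hD.series _ _ (harmBasis_spec hn) h).congr fun K => ?_
    rw [norm_toL2_sq]
    refine integral_congr_ae (ae_of_all _ fun x => ?_)
    simp only [F, Schwartz.sub_apply, Schwartz.sum_apply, Schwartz.smul_apply, harmProj_apply]
  have h2 : Tendsto (fun K => Schwartz.toL2 n (F K)) atTop (𝓝 0) := by
    rw [tendsto_zero_iff_norm_tendsto_zero]
    simpa using h1.sqrt
  have h3 : Tendsto (fun K => sphInner (F K) Z) atTop (𝓝 0) := by
    have := ((innerSL ℂ (Schwartz.toL2 n Z)).continuous.tendsto 0).comp h2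
    rw [map_zero] at this
    refine this.congr fun K => (sphInner_eq_inner _ _).symm
  have h4 : ∀ K, k < K → sphInner (F K) Z = sphInner (D h) Z - a k * sphInner h Z := by
    intro K hK
    have hs : sphInner (∑ j ∈ Finset.range K, (a j : ℂ) • harmProj hn j h) Z =
        a k * sphInner h Z := by
      rw [sphInner_sum_left, Finset.sum_eq_single k]
      · rw [sphInner_smul_left, sphInner_harmProj hn h hZ]
      · intro j _ hj
        rw [sphInner_smul_left, sphInner_eq_zero hn hj (harmProj_mem hn j h) hZ, mul_zero]
      · exact fun hk => absurd (Finset.mem_range.2 hK) hk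
    rw [← hs]
    simp only [F, sphInner_eq_inner, map_sub, inner_sub_right]
  have h5 : Tendsto (fun K => sphInner (F K) Z) atTop
      (𝓝 (sphInner (D h) Z - a k * sphInner h Z)) :=
    tendsto_const_nhds.congr' ((eventually_gt_atTop k).mono fun K hK => (h4 K hK).symm)
  exact sub_eq_zero.1 (tendsto_nhds_unique h5 h3)

theorem apply_sphHarm (hn : 1 ≤ n) (hD : IsPseudoDiffOp D a p) {k : ℕ} {Y : Schwartz n}
    (hY : Y ∈ sphHarm n k) : D Y = (a k : ℂ) • Y := by
  refine eq_of_sphInner_eq hn fun j Z hZ => ?_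
  rw [hD.sphInner_apply hn Y hZ, sphInner_smul_left]
  rcases eq_or_ne k j with rfl | hkj
  · rfl
  · rw [sphInner_eq_zero hn hkj hY hZ, mul_zero, mul_zero]

/-- If `D` is injective, its symbol vanishes at most at those `k` for which there are no spherical
harmonics of order `k` other than `0`. -/
theorem symbol_ne_zero (hn : 1 ≤ n) (hD : IsPseudoDiffOp D a p) (hker : LinearMap.ker D = ⊥)
    {k : ℕ} {Y : Schwartz n} (hY : Y ∈ sphHarm n k) (h0 : Y ≠ 0) : (a k : ℂ) ≠ 0 := by
  intro ha
  refine h0 (LinearMap.ker_eq_bot'.1 hker Y ?_)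
  rw [hD.apply_sphHarm hn hY, ha, zero_smul]

theorem exists_norm_symbol_le (hD : IsPseudoDiffOp D a p) :
    ∃ (C : ℝ) (q : ℕ), ∀ k, ‖(a k : ℂ)‖ ≤ C * ((k : ℝ) + 1) ^ q := by
  have h1 : (fun k : ℕ => (k : ℝ) ^ p) =O[atTop] fun k : ℕ => ((k : ℝ) + 1) ^ ⌈p⌉₊ := by
    refine Asymptotics.IsBigO.of_bound' (Eventually.of_forall fun k => ?_)
    have hk : (0 : ℝ) ≤ k := k.cast_nonneg
    rw [Real.norm_of_nonneg (Real.rpow_nonneg hk p), Real.norm_of_nonneg (by positivity),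
      ← Real.rpow_natCast]
    exact (Real.rpow_le_rpow hk (by linarith) hD.order_nonneg).trans
      (Real.rpow_le_rpow_of_exponent_le (by linarith) (Nat.le_ceil p))
  obtain ⟨C, -, hC⟩ := Asymptotics.bound_of_isBigO_nat_atTop (hD.growth.1.trans h1)
  refine ⟨C, ⌈p⌉₊, fun k => ?_⟩
  have hk : (0 : ℝ) < ((k : ℝ) + 1) ^ ⌈p⌉₊ := by positivity
  simpa [abs_of_pos hk, -norm_pow] using hC hk.ne'

/-- The inverse of the symbol is bounded, since `p ≥ 0`. The finitely many zeros of the symbol play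
no role, as `0⁻¹ = 0`. -/
theorem exists_norm_inv_symbol_le (hD : IsPseudoDiffOp D a p) :
    ∃ C : ℝ, ∀ k, ‖((a k : ℂ))⁻¹‖ ≤ C * ((k : ℝ) + 1) ^ 0 := by
  have h1 : (fun _ : ℕ => (1 : ℝ)) =O[atTop] fun k : ℕ => (k : ℝ) ^ p := by
    refine Asymptotics.IsBigO.of_bound' ((eventually_ge_atTop 1).mono fun k hk => ?_)
    have hk : (1 : ℝ) ≤ k := by exact_mod_cast hk
    rw [norm_one, Real.norm_of_nonneg (by positivity)]
    exact Real.one_le_rpow hk hD.order_nonneg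
  have h2 := (h1.trans hD.growth.2).inv_rev (Eventually.of_forall fun k h => absurd h one_ne_zero)
  obtain ⟨C, -, hC⟩ := Asymptotics.bound_of_isBigO_nat_atTop h2
  refine ⟨C, fun k => ?_⟩
  simpa using hC (x := k) (by simp)

/-- The linear functional `D η` is a distribution, for `η` continuous. -/
theorem continuous_contFun_comp (hn : 1 ≤ n) (hD : IsPseudoDiffOp D a p) (η : C(Sph n, ℂ)) :
    Continuous (contFun η ∘ₗ D) := by
  obtain ⟨C, q, hC⟩ := hD.exists_norm_symbol_le
  obtain ⟨J, M, hM, hJ⟩ := exists_norm_multiplier_le hn hC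
  have h1 : ∀ h, ‖Schwartz.toCont n (D h)‖ ≤ M * sphSeminorms n J h := by
    intro h
    rw [← multiplier_eq hn hC (h := h) fun k Z hZ => hD.sphInner_apply hn h hZ]
    exact hJ h
  refine continuous_of_seminorm_bound _ (‖η‖ * M * (sphMeasure n).real Set.univ) J fun φ => ?_
  refine (norm_integral_le_of_norm_le_const (C := ‖η‖ * (M * sphSeminorms n J φ))
    (ae_of_all _ fun x => ?_)).trans_eq (by ring)
  rw [norm_mul]
  exact mul_le_mul (η.norm_coe_le_norm x)
    (((Schwartz.toCont n (D φ)).norm_coe_le_norm x).trans (h1 φ)) (norm_nonneg _) (norm_nonneg _)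

/-- The inverse of `D` as the multiplier with symbol `1 / a`. It maps smooth functions to continuous
functions, and is a left inverse of `D`. Surjectivity of `D` on the smooth functions is not
needed. -/
theorem exists_leftInverse (hn : 1 ≤ n) (hD : IsPseudoDiffOp D a p) (hker : LinearMap.ker D = ⊥) :
    ∃ T : Schwartz n →ₗ[ℂ] C(Sph n, ℂ),
      (∃ (J : ℕ) (M : ℝ), ∀ φ, ‖T φ‖ ≤ M * sphSeminorms n J φ) ∧
      (∀ h, T (D h) = Schwartz.toCont n h) ∧
      ∀ φ ψ, contDist n (T φ) (D ψ) = contDist n (Schwartz.toCont n φ) ψ := by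
  obtain ⟨C, hC⟩ := hD.exists_norm_inv_symbol_le
  refine ⟨multiplier hn hC, ?_, fun h => multiplier_eq hn hC fun k Z hZ => ?_, fun φ ψ => ?_⟩
  · obtain ⟨J, M, -, hJ⟩ := exists_norm_multiplier_le hn hC
    exact ⟨J, M, hJ⟩
  · rcases eq_or_ne Z 0 with rfl | hZ0
    · simp [sphInner_eq_inner]
    · rw [hD.sphInner_apply hn h hZ, inv_mul_cancel_left₀ (hD.symbol_ne_zero hn hker hZ hZ0)]
  · -- both sides are distributions in `ψ`, which agree on the spherical harmonics
    let L : SphDist n := ⟨contFun (multiplier hn hC φ) ∘ₗ D, hD.continuous_contFun_comp hn _⟩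
    have hL : L - contDist n (Schwartz.toCont n φ) = 0 := by
      refine sphDist_eq_zero hn _ fun k Y hY => ?_
      change contDist n (multiplier hn hC φ) (D Y) - contDist n (Schwartz.toCont n φ) Y = 0
      rcases eq_or_ne Y 0 with rfl | hY0
      · simp
      · rw [hD.apply_sphHarm hn hY, map_smul, ← inner_toL2_conj, ← inner_toL2_conj,
          sphInner_multiplier hn hC φ (conj_mem_sphHarm hY), smul_eq_mul,
          mul_inv_cancel_left₀ (hD.symbol_ne_zero hn hker hY hY0), sphInner_eq_inner]
        exact sub_self _
    exact DFunLike.congr_fun (sub_eq_zero.1 hL) ψ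

/-- A distribution is determined by its image under `D`. -/
theorem distMap_injective (hn : 1 ≤ n) (hD : IsPseudoDiffOp D a p) (hker : LinearMap.ker D = ⊥) :
    Function.Injective (distMap D) := by
  refine (injective_iff_map_eq_zero _).2 fun f hf => sphDist_eq_zero hn f fun k Y hY => ?_
  rcases eq_or_ne Y 0 with rfl | hY0
  · exact map_zero f
  · have h1 : f (D Y) = 0 := LinearMap.congr_fun hf Y
    rw [hD.apply_sphHarm hn hY, map_smul, smul_eq_mul] at h1
    exact (mul_eq_zero.1 h1).resolve_left (hD.symbol_ne_zero hn hker hY hY0)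

end IsPseudoDiffOp

/-! ### The two spaces as isometric images -/

section Spaces

variable {n : ℕ} {D : Schwartz n →ₗ[ℂ] Schwartz n} {a : ℕ → ℝ} {p : ℝ}

theorem relNorm_eq {V X : Type*} {R : V → X → Prop} {q : X → ℝ} {v : V} {x : X} (hx : R v x)
    (hu : ∀ y, R v y → y = x) : relNorm R q v = q x := by
  have : {y | R v y} = {x} := Set.eq_singleton_iff_unique_mem.2 ⟨hx, hu⟩
  rw [relNorm, this, Set.image_singleton, csInf_singleton]

theorem CD.toDist_injective : Function.Injective (CD.toDist (D := D)) := Subtype.val_injective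

theorem MD.toDist_injective : Function.Injective (MD.toDist (D := D)) := Subtype.val_injective

/-- The map `η ↦ D η` from the continuous functions to `C_D`. -/
def cdMap (hn : 1 ≤ n) (hD : IsPseudoDiffOp D a p) : C(Sph n, ℂ) →ₗ[ℂ] CD D where
  toFun η := ⟨⟨contFun η ∘ₗ D, hD.continuous_contFun_comp hn η⟩, η, rfl⟩
  map_add' η θ := CD.toDist_injective <| ContinuousLinearMap.ext fun φ =>
    DFunLike.congr_fun (map_add (contDist n) η θ) (D φ)
  map_smul' c η := CD.toDist_injective <| ContinuousLinearMap.ext fun φ =>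
    DFunLike.congr_fun (map_smul (contDist n) c η) (D φ)

theorem isImage_cdMap (hn : 1 ≤ n) (hD : IsPseudoDiffOp D a p) (η : C(Sph n, ℂ)) :
    IsImage D (cdMap hn hD η).toDist η := rfl

theorem eq_cdMap (hn : 1 ≤ n) (hD : IsPseudoDiffOp D a p) {h : CD D} {η : C(Sph n, ℂ)}
    (hη : IsImage D h.toDist η) : h = cdMap hn hD η :=
  CD.toDist_injective (ContinuousLinearMap.coe_injective (hη.trans (isImage_cdMap hn hD η).symm))

theorem isImage_unique (hn : 1 ≤ n) (hD : IsPseudoDiffOp D a p) (hker : LinearMap.ker D = ⊥)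
    {h : SphDist n} {η θ : C(Sph n, ℂ)} (hη : IsImage D h η) (hθ : IsImage D h θ) : η = θ :=
  contDist_injective hn (hD.distMap_injective hn hker (hη.symm.trans hθ))

theorem norm_eq_of_isImage (hn : 1 ≤ n) (hD : IsPseudoDiffOp D a p) (hker : LinearMap.ker D = ⊥)
    {h : CD D} {η : C(Sph n, ℂ)} (hη : IsImage D h.toDist η) : ‖h‖ = ‖η‖ :=
  relNorm_eq (R := fun (h : CD D) η => IsImage D h.toDist η) hη fun _ hθ =>
    isImage_unique hn hD hker hθ hη

/-- `C_D` is isometric to the space of continuous functions, through `η ↦ D η`. -/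
def cdEquiv (hn : 1 ≤ n) (hD : IsPseudoDiffOp D a p) (hker : LinearMap.ker D = ⊥) :
    C(Sph n, ℂ) ≃ₗᵢ[ℂ] CD D :=
  LinearIsometryEquiv.ofSurjective
    ⟨cdMap hn hD, fun η => norm_eq_of_isImage hn hD hker (isImage_cdMap hn hD η)⟩
    fun h => h.2.imp fun _ hη => (eq_cdMap hn hD hη).symm

theorem isPrimitive_unique_left (hn : 1 ≤ n) (hD : IsPseudoDiffOp D a p)
    (hker : LinearMap.ker D = ⊥) {f g : MD D} {μ : ComplexMeasure (Sph n)}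
    (hf : IsPrimitive D f.toDist μ) (hg : IsPrimitive D g.toDist μ) : f = g :=
  MD.toDist_injective (hD.distMap_injective hn hker (hf.trans hg.symm))

theorem isPrimitive_unique_right (hn : 1 ≤ n) {f : SphDist n} {μ ν : ComplexMeasure (Sph n)}
    (hμ : IsPrimitive D f μ) (hν : IsPrimitive D f ν) : μ = ν :=
  measFun_injective hn (hμ.symm.trans hν)

theorem norm_eq_of_isPrimitive (hn : 1 ≤ n) {f : MD D} {μ : ComplexMeasure (Sph n)}
    (hμ : IsPrimitive D f.toDist μ) : ‖f‖ = tvNorm μ :=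
  relNorm_eq (R := fun (f : MD D) μ => IsPrimitive D f.toDist μ) hμ fun _ hν =>
    isPrimitive_unique_right hn hν hμ

/-- The solution of `D f = μ`, for `μ` given as an element of the dual of `C(𝕊, ℂ)`: it is
`f = μ ∘ T`, where `T` is a left inverse of `D` with values in the continuous functions, bounded by
one of the seminorms. -/
def mdMap (T : Schwartz n →ₗ[ℂ] C(Sph n, ℂ))
    (hT : ∃ (J : ℕ) (M : ℝ), ∀ φ, ‖T φ‖ ≤ M * sphSeminorms n J φ)
    (hTD : ∀ h, T (D h) = Schwartz.toCont n h) : (C(Sph n, ℂ) →L[ℂ] ℂ) →ₗ[ℂ] MD D where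
  toFun L := ⟨⟨(L : C(Sph n, ℂ) →ₗ[ℂ] ℂ) ∘ₗ T, by
      obtain ⟨J, M, hJ⟩ := hT
      refine continuous_of_seminorm_bound _ (‖L‖ * M) J fun φ => ?_
      refine (L.le_opNorm (T φ)).trans ?_
      rw [mul_assoc]
      exact mul_le_mul_of_nonneg_left (hJ φ) (norm_nonneg L)⟩, by
    obtain ⟨μ, hμ⟩ := exists_measPair_eq L
    refine ⟨μ, LinearMap.ext fun φ => ?_⟩
    exact (congrArg L (hTD φ)).trans (hμ _).symm⟩
  map_add' _ _ := rfl
  map_smul' _ _ := rfl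

section Primitive

variable {T : Schwartz n →ₗ[ℂ] C(Sph n, ℂ)}
  (hT : ∃ (J : ℕ) (M : ℝ), ∀ φ, ‖T φ‖ ≤ M * sphSeminorms n J φ)
  (hTD : ∀ h, T (D h) = Schwartz.toCont n h)

/-- `D (μ ∘ T) = μ`, because `T ∘ D` is the inclusion of the smooth functions. -/
theorem isPrimitive_mdMap (μ : ComplexMeasure (Sph n)) :
    IsPrimitive D (mdMap T hT hTD (measCLM μ)).toDist μ :=
  LinearMap.ext fun φ => congrArg (measCLM μ) (hTD φ)

theorem exists_eq_measCLM (L : C(Sph n, ℂ) →L[ℂ] ℂ) : ∃ μ, L = measCLM μ :=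
  (exists_measPair_eq L).imp fun _ hμ => ContinuousLinearMap.ext fun η => (hμ η).symm

theorem norm_mdMap (hn : 1 ≤ n) (L : C(Sph n, ℂ) →L[ℂ] ℂ) : ‖mdMap T hT hTD L‖ = ‖L‖ := by
  obtain ⟨μ, rfl⟩ := exists_eq_measCLM L
  rw [norm_measCLM]
  exact norm_eq_of_isPrimitive hn (isPrimitive_mdMap hT hTD μ)

/-- `M_D` is isometric to the dual of `C(𝕊, ℂ)`. -/
def mdEquiv (hn : 1 ≤ n) (hD : IsPseudoDiffOp D a p) (hker : LinearMap.ker D = ⊥) :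
    (C(Sph n, ℂ) →L[ℂ] ℂ) ≃ₗᵢ[ℂ] MD D where
  toLinearEquiv := LinearEquiv.ofBijective (mdMap T hT hTD)
    ⟨(injective_iff_map_eq_zero _).2 fun L hL => by
        rw [← ContinuousLinearMap.opNorm_zero_iff, ← norm_mdMap hT hTD hn, hL]
        exact norm_zero,
      fun f => by
        obtain ⟨μ, hμ⟩ := f.2
        exact ⟨measCLM μ, isPrimitive_unique_left hn hD hker (isPrimitive_mdMap hT hTD μ) hμ⟩⟩
  norm_map' := norm_mdMap hT hTD hn

end Primitive

/-- The isometry of dual spaces induced by an isometry. -/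
def LinearIsometryEquiv.dualCongr {E F : Type*} [SeminormedAddCommGroup E] [NormedSpace ℂ E]
    [SeminormedAddCommGroup F] [NormedSpace ℂ F] (e : E ≃ₗᵢ[ℂ] F) :
    (E →L[ℂ] ℂ) ≃ₗᵢ[ℂ] (F →L[ℂ] ℂ) where
  toFun L := L ∘L (e.symm.toContinuousLinearEquiv : F →L[ℂ] E)
  invFun L := L ∘L (e.toContinuousLinearEquiv : E →L[ℂ] F)
  left_inv L := by
    ext x
    simp
  right_inv L := by
    ext x
    simp
  map_add' _ _ := rfl
  map_smul' _ _ := rfl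
  norm_map' L := by
    refine le_antisymm (ContinuousLinearMap.opNorm_le_bound _ (norm_nonneg L) fun y => ?_)
      (ContinuousLinearMap.opNorm_le_bound _ (norm_nonneg _) fun x => ?_)
    · exact (L.le_opNorm (e.symm y)).trans_eq (by rw [e.symm.norm_map])
    · have h := (L ∘L (e.symm.toContinuousLinearEquiv : F →L[ℂ] E)).le_opNorm (e x)
      rw [e.norm_map] at h
      simpa using h

end Spaces

end

theorem proposition6 (n : ℕ) (hn : 1 ≤ n) (D : Schwartz n →ₗ[ℂ] Schwartz n) (a : ℕ → ℝ) (p : ℝ)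
    (hD : IsPseudoDiffOp D a p) (hker : LinearMap.ker D = ⊥) :
    -- `(C_D, ‖D⁻¹ h‖_∞)` is a Banach space
    ((∀ η : C(Sph n, ℂ), ∃! h : CD D, IsImage D h.toDist η) ∧
      (∀ h : CD D, ∃! η : C(Sph n, ℂ), IsImage D h.toDist η) ∧
      (∀ (h : CD D) (η : C(Sph n, ℂ)), IsImage D h.toDist η → ‖h‖ = ‖η‖) ∧
      (∀ h : CD D, ‖h‖ = 0 → h = 0) ∧
      CompleteSpace (CD D)) ∧
    -- `(M_D, ‖D f‖_TV)` is a Banach space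
    ((∀ μ : ComplexMeasure (Sph n), ∃! f : MD D, IsPrimitive D f.toDist μ) ∧
      (∀ f : MD D, ∃! μ : ComplexMeasure (Sph n), IsPrimitive D f.toDist μ) ∧
      (∀ (f : MD D) (μ : ComplexMeasure (Sph n)), IsPrimitive D f.toDist μ → ‖f‖ = tvNorm μ) ∧
      (∀ f : MD D, IsLUB {r : ℝ | ∃ φ : Schwartz n, ‖Schwartz.toCont n φ‖ = 1 ∧
        r = ‖f.toDist (D φ)‖} ‖f‖) ∧
      (∀ f : MD D, ‖f‖ = 0 → f = 0) ∧
      CompleteSpace (MD D)) ∧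
    -- `M_D` is the topological dual of `C_D`, through the duality product
    ∃ Φ : MD D ≃ₗᵢ[ℂ] (CD D →L[ℂ] ℂ),
      (∀ (f : MD D) (h : CD D) (μ : ComplexMeasure (Sph n)) (η : C(Sph n, ℂ)),
        IsPrimitive D f.toDist μ → IsImage D h.toDist η → Φ f h = measPair μ η) ∧
      (∀ φ : Schwartz n, ∃ h : CD D, h.toDist = contDist n (Schwartz.toCont n φ) ∧
        ∀ f : MD D, Φ f h = f.toDist φ) := by
  obtain ⟨T, hT, hTD, hTsymm⟩ := hD.exists_leftInverse hn hker
  let eC := cdEquiv hn hD hker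
  let eM := mdEquiv hT hTD hn hD hker
  refine ⟨⟨?_, ?_, ?_, ?_, ?_⟩, ⟨?_, ?_, ?_, ?_, ?_, ?_⟩, eM.symm.trans eC.dualCongr, ?_, ?_⟩
  · exact fun η => ⟨cdMap hn hD η, isImage_cdMap hn hD η, fun _ hh => eq_cdMap hn hD hh⟩
  · intro h
    obtain ⟨η, hη⟩ := h.2
    exact ⟨η, hη, fun θ hθ => isImage_unique hn hD hker hθ hη⟩
  · exact fun h η hη => norm_eq_of_isImage hn hD hker hη
  · intro h h0
    rw [← eC.symm.norm_map, norm_eq_zero] at h0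
    rw [← eC.apply_symm_apply h, h0, map_zero]
  · exact eC.symm.toIsometryEquiv.completeSpace
  · exact fun μ => ⟨_, isPrimitive_mdMap hT hTD μ, fun g hg =>
      isPrimitive_unique_left hn hD hker hg (isPrimitive_mdMap hT hTD μ)⟩
  · intro f
    obtain ⟨μ, hμ⟩ := f.2
    exact ⟨μ, hμ, fun ν hν => isPrimitive_unique_right hn hν hμ⟩
  · exact fun f μ hμ => norm_eq_of_isPrimitive hn hμ
  · intro f
    obtain ⟨μ, hμ⟩ := f.2
    rw [norm_eq_of_isPrimitive hn hμ]
    have hDf : ∀ φ, f.toDist (D φ) = measPair μ (Schwartz.toCont n φ) := LinearMap.congr_fun hμ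
    simpa only [hDf] using isLUB_tvNorm hn μ
  · intro f h0
    rw [← eM.symm.norm_map, ContinuousLinearMap.opNorm_zero_iff] at h0
    rw [← eM.apply_symm_apply f, h0]
    exact eM.toLinearEquiv.map_zero
  · exact eM.symm.toIsometryEquiv.completeSpace
  · -- `Φ f h = L (D⁻¹ h)`, where `L` is the functional on `C(𝕊, ℂ)` with `f = L ∘ T`
    intro f h μ η hμ hη
    have hf : eM (measCLM μ) = f :=
      isPrimitive_unique_left hn hD hker (isPrimitive_mdMap hT hTD μ) hμ
    have hh : eC η = h := (eq_cdMap hn hD hη).symm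
    change eM.symm f (eC.symm h) = measPair μ η
    rw [← hf, ← hh, eM.symm_apply_apply, eC.symm_apply_apply, measCLM_apply]
  · intro φ
    refine ⟨eC (T φ), ContinuousLinearMap.ext fun ψ => hTsymm φ ψ, fun f => ?_⟩
    obtain ⟨L, rfl⟩ := eM.surjective f
    change eM.symm (eM L) (eC.symm (eC (T φ))) = L (T φ)
    rw [eM.symm_apply_apply, eC.symm_apply_apply]
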